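/- **Definitions.** Automata are deterministic and finite, with a possibly partial transition function and one initial state. For a word $w$ and $k\ge 1$ let $i_{k-1}(w)$ and $t_{k-1}(w)$ be the prefix and suffix of $w$ of length $k-1$ (or $w$ itself if $|w|<k-1$) and $F_k(w)$ the set of factors of $w$ of length $k$. A language $L$ over $\Sigma$ is $k$-testable if any $u,v\in\Sigma^+$ with $i_{k-1}(u)=i_{k-1}(v)$, $t_{k-1}(u)=t_{k-1}(v)$, $F_k(u)=F_k(v)$ are both in $L$ or both not in $L$. A semigroup $S$ is $k$-testable if for some alphabet $\Sigma$ there is a surjective morphism $\phi:\Sigma^+\to S$ such that $u\phi=v\phi$ for all such $u,v$. An automaton is $k$-testable if its language is, and locally testable if it is $k$-testable for some $k\geq 1$; the least such $k$ is its order of local testability, and it is then called precisely $k$-testable. The identity $\beta$ of $n$-testability is $$x_1\cdots x_{n-1}\,y\,x_1\cdots x_{n-1}\,z\,x_1\cdots x_{n-1}=x_1\cdots x_{n-1}\,z\,x_1\cdots x_{n-1}\,y\,x_1\cdots x_{n-1}$$ (for $n=1$: $yz=zy$). The automaton is reduced if every state is reachable from the initial state and any two words $u,v$ such that $uw\in L\Leftrightarrow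 vw\in L$ for all words $w$ lead from the initial state to the same state or are both undefined there. Its transition semigroup is generated by the partial transformations of the states induced by the letters. Write $p\succeq q$ if the state $q$ is reachable from the state $p$, $p\succ q$ if moreover $p\ne q$, and $p\sim q$ ($p,q$ belong to one strongly connected component, SCC) if $p\succeq q$ and $q\succeq p$. The nodes of the 2-tuple graph $\Gamma\Gamma$ are the pairs $(p,q)$ of states with $p\succ q$; there is an edge $(p,q)\to(r,t)$ if $p\sigma=r$ and $q\sigma=t$ for some letter $\sigma$. The length of a path is its number of edges, and a path is simple if its nodes are pairwise distinct. A path $(p_1,q_1),\dots,(p_m,q_m)$ in $\Gamma\Gamma$ is SCC-restricted if all $p_i,q_i$ belong to one SCC; it is SCC-semirestricted if for some letter $\sigma$ the state $q_m\sigma$ is defined, $q_m\sigma\succeq q_1$, and $q_m\sigma$ is not reachable from $p_m\sigma$ (in particular, this last condition holds if $p_m\sigma$ is undefined). **Theorem 3.10.** Let $\mathbf A$ be a locally testable reduced deterministic finite automaton with transition semigroup $S$ and 2-tuple graph $\Gamma\Gamma$, and let $k\ge 2$. Suppose that $k-2$ is the maximum of the lengths of all paths in $\Gamma\Gamma$ that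 are SCC-restricted or SCC-semirestricted. Then the identity $\beta$ of $(k-1)$-testability does not hold in $S$, neither $S$ nor $\mathbf A$ is $(k-1)$-testable, and $k$ is a lower bound on the order of local testability of $\mathbf A$. If, moreover, every simple path in $\Gamma\Gamma$ has length at most $k-2$, then $\mathbf A$ is precisely $k$-testable. -/

import Mathlib

universe u v

/-! ### Testability of languages and of semigroups -/

/-- The words `u` and `v` have the same prefix of length `k - 1` (the whole word if it is shorter),
the same suffix of length `k - 1`, and the same set of factors of length `k`. -/
def SameTestData {α : Type u} (k : ℕ) (u v : List α) : Prop :=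
  u.take (k - 1) = v.take (k - 1) ∧
  u.rtake (k - 1) = v.rtake (k - 1) ∧
  {f : List α | f.length = k ∧ f <:+: u} = {f : List α | f.length = k ∧ f <:+: v}

/-- A language is `k`-testable (`k ≥ 1`) if membership of a nonempty word depends only on its
prefix and suffix of length `k - 1` and its set of factors of length `k`. -/
def IsTestableLanguage {α : Type u} (k : ℕ) (L : Language α) : Prop :=
  0 < k ∧ ∀ u v : List α, u ≠ [] → v ≠ [] → SameTestData k u v → (u ∈ L ↔ v ∈ L)

/-- A semigroup `S` is `k`-testable (`k ≥ 1`) if for some alphabet `A` there is a surjective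
morphism from the free semigroup on `A` to `S` that identifies any two words with the same
prefix and suffix of length `k - 1` and the same factors of length `k`. -/
def IsTestableSemigroup (k : ℕ) (S : Type u) [Semigroup S] : Prop :=
  0 < k ∧ ∃ (A : Type u) (φ : FreeSemigroup A →ₙ* S), Function.Surjective φ ∧
    ∀ u v : FreeSemigroup A,
      SameTestData k (u.head :: u.tail) (v.head :: v.tail) → φ u = φ v

/-- The identity `β` of `n`-testability:
`x₁⋯xₙ₋₁ y x₁⋯xₙ₋₁ z x₁⋯xₙ₋₁ = x₁⋯xₙ₋₁ z x₁⋯xₙ₋₁ y x₁⋯xₙ₋₁` holds in `S`.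
The products are formed in `S` with a unit adjoined, so that for `n = 1` the product `x₁⋯xₙ₋₁`
is empty and the identity reads `y z = z y`. -/
def SatisfiesBeta (n : ℕ) (S : Type u) [Semigroup S] : Prop :=
  ∀ (x : Fin (n - 1) → S) (y z : S),
    let X : WithOne S := (List.ofFn fun i => (x i : WithOne S)).prod
    X * y * X * z * X = X * z * X * y * X

/-! ### Partial transformations -/

/-- Partial transformations of a set, acting on the right. -/
def PartialTransf (σ : Type u) : Type u := σ → Option σ

/-- The product `f * g` is: first `f`, then `g`. -/
instance PartialTransf.instSemigroup (σ : Type u) : Semigroup (PartialTransf σ) where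
  mul f g := fun p => (f p).bind g
  mul_assoc f g h := by
    funext p
    exact Option.bind_assoc (f p) g h

/-! ### Deterministic automata with a partial transition function -/

/-- A deterministic automaton; `step p a = none` means that the transition is undefined.
A complete automaton is one whose `step` never takes the value `none`. -/
structure PartialDFA (α : Type u) (σ : Type v) where
  /-- the partial transition function -/
  step : σ → α → Option σ
  /-- the initial state -/
  start : σ
  /-- the accepting states -/
  accept : Set σ

namespace PartialDFA

variable {α : Type u} {σ : Type v} (M : PartialDFA α σ)

/-- The state reached from `p` by reading a word, if it is defined. -/
def run (p : σ) : List α → Option σ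
  | [] => some p
  | a :: w => (M.step p a).bind fun q => run q w

/-- The accepted language. -/
def accepts : Language α :=
  {w : List α | ∃ q ∈ M.accept, M.run M.start w = some q}

/-- The automaton is reduced: every state is reachable from the initial state, and two words that
cannot be distinguished by a continuation lead from the initial state to the same state, or are
both undefined there.  This covers both minimal complete automata and trimmed minimal
partial automata. -/
def IsReduced : Prop :=
  (∀ q, ∃ w, M.run M.start w = some q) ∧
  ∀ u v : List α, (∀ w, u ++ w ∈ M.accepts ↔ v ++ w ∈ M.accepts) →
    M.run M.start u = M.run M.start v

/-- The automaton is `k`-testable: it accepts a `k`-testable language. -/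
def IsTestable (k : ℕ) : Prop := IsTestableLanguage k M.accepts

/-- The automaton is locally testable: it is `k`-testable for some `k`. -/
def IsLocallyTestable : Prop := ∃ k, M.IsTestable k

/-- The automaton is precisely `k`-testable: its order of local testability, the least `j` for
which it is `j`-testable, equals `k`. -/
def IsPreciselyTestable (k : ℕ) : Prop := IsLeast {j | M.IsTestable j} k

/-- The transition semigroup: the semigroup of partial transformations of the set of states
generated by the actions of the letters. -/
def transitionSemigroup : Subsemigroup (PartialTransf σ) :=
  Subsemigroup.closure (Set.range fun (a : α) (p : σ) => M.step p a)

/-! ### The state transition graph and the 2-tuple graph -/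

/-- `q` is reachable from `p` in the state transition graph (`p ⪰ q`). -/
def Reaches (p q : σ) : Prop := ∃ w, M.run p w = some q

/-- `p ≻ q`: `q` is reachable from `p` and distinct from it. -/
def StrictlyReaches (p q : σ) : Prop := M.Reaches p q ∧ p ≠ q

/-- `p ∼ q`: the states belong to one strongly connected component. -/
def SameSCC (p q : σ) : Prop := M.Reaches p q ∧ M.Reaches q p

/-- The nodes of the 2-tuple graph: the pairs `(p, q)` with `p ≻ q`. -/
def TupleNode : Type v := {x : σ × σ // M.StrictlyReaches x.1 x.2}

/-- There is an edge labelled `a` from `x` to `y` in the 2-tuple graph. -/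
def TupleEdge (x : M.TupleNode) (a : α) (y : M.TupleNode) : Prop :=
  M.step x.1.1 a = some y.1.1 ∧ M.step x.1.2 a = some y.1.2

/-- A path with `n` edges in the 2-tuple graph, as its sequence of nodes. -/
structure TuplePath (n : ℕ) where
  /-- the nodes of the path -/
  node : Fin (n + 1) → M.TupleNode
  /-- consecutive nodes are joined by an edge -/
  edge : ∀ i : Fin n, ∃ a, M.TupleEdge (node i.castSucc) a (node i.succ)

namespace TuplePath

variable {M} {n : ℕ} (P : M.TuplePath n)

/-- A path without loops. -/
def IsSimple : Prop := Function.Injective P.node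

/-- All components of the nodes of the path belong to one strongly connected component of the
state transition graph. -/
def IsSCCRestricted : Prop :=
  ∃ c : σ, ∀ i, M.SameSCC c (P.node i).1.1 ∧ M.SameSCC c (P.node i).1.2

/-- For the first node `(p₁, q₁)` and the last node `(pₘ, qₘ)` of the path there is a letter `a`
such that `qₘ a` is defined, `q₁` is reachable from `qₘ a`, and `qₘ a` is not reachable from
`pₘ a` (in particular, this holds if `pₘ a` is undefined). -/
def IsSCCSemirestricted : Prop :=
  ∃ (a : α) (q : σ), M.step (P.node (Fin.last n)).1.2 a = some q ∧
    M.Reaches q (P.node 0).1.2 ∧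
    ¬ ∃ p : σ, M.step (P.node (Fin.last n)).1.1 a = some p ∧ M.Reaches p q

end TuplePath

end PartialDFA

/-! Lower bound. A path of length `k - 2` in the 2-tuple graph is labelled by a word `X` of length
`k - 2`, exactly the length of the repeated block in the identity for `k - 1`. Substituting `X` with
suitable `y` and `z` separates the two sides on the first state of the path. In a reduced automaton,
testability of the language means that words with the same test data act equally on states. This
forces the identity in the transition semigroup, so its failure rules out testability; since
testability is monotone in the order, `k` is a lower bound.

Upper bound. Put `n = k - 1`, so simple paths have at most `n` nodes. A word is viewed as a walk on
its windows of length `n`, whose edges are its factors of length `n + 1`. By a theorem in the style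
of Simon (`IsLocalSemilatticeCongruence.of_same_factors`), two walks with the same ends and the same
edges are congruent as soon as closed walks at each window are idempotent and commute. It remains to
check this for the action on states.

Local testability of some unknown order `m` enters only through words longer than `m`, namely powers
of a word `e`. Distinct states of one component cannot both be fixed by `e`
(`RunTestable.eq_of_fixed`), and if `p` reaches `q` and both are fixed by `e`, the same words can be
continued to `q` from either (`RunTestable.reaches_iff_of_fixed`). Among `n + 1` successive nodes
some node repeats, which provides such an `e`. Commutation follows by comparing components.
Idempotence concerns a run on a periodic word, and the exact bound needs a loop-erased path with `n
+ 1` nodes (`SimplePathsShorter.eq_add_period_of_run`). -/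

/-! ### Factors of words -/

namespace List

variable {α : Type u}

/-- The set of factors of length `k` of a word. -/
def factorsOfLength (k : ℕ) (u : List α) : Set (List α) := {f | f.length = k ∧ f <:+: u}

/-- A factor that meets both `A` and `B` would contain `X` and at least two more letters. The bound
`X.length + 1` is what makes factors additive when words are glued along a common window. -/
theorem infix_append_append_iff {A X B f : List α} (hf : f.length ≤ X.length + 1) :
    f <:+: A ++ X ++ B ↔ f <:+: A ++ X ∨ f <:+: X ++ B := by
  constructor
  · rintro ⟨s, t, h⟩
    by_cases hl : s.length + f.length ≤ A.length + X.length
    · left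
      have h1 : s ++ f <+: A ++ X ++ B := ⟨t, h⟩
      have h2 : A ++ X <+: A ++ X ++ B := prefix_append _ _
      have h3 := prefix_of_prefix_length_le h1 h2 (by simpa using hl)
      exact (suffix_append s f).isInfix.trans h3.isInfix
    · right
      have h1 : f ++ t <:+ A ++ (X ++ B) := ⟨s, by simpa using h⟩
      have h2 : X ++ B <:+ A ++ (X ++ B) := suffix_append _ _
      have hlen := congrArg length h
      simp only [length_append] at hlen
      have h3 := suffix_of_suffix_length_le h1 h2 (by simp only [length_append]; omega)
      exact (prefix_append f t).isInfix.trans h3.isInfix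
  · rintro (h | h)
    · exact h.trans (prefix_append _ _).isInfix
    · rw [append_assoc]
      exact h.trans (suffix_append _ _).isInfix

theorem factorsOfLength_mono {k : ℕ} {u v : List α} (h : u <:+: v) :
    factorsOfLength k u ⊆ factorsOfLength k v := fun _ hf => ⟨hf.1, hf.2.trans h⟩

theorem factorsOfLength_append {k : ℕ} {U X B : List α} (hX : X <:+ U) (hk : k ≤ X.length + 1) :
    factorsOfLength k (U ++ B) = factorsOfLength k U ∪ factorsOfLength k (X ++ B) := by
  obtain ⟨A, rfl⟩ := hX
  ext f
  constructor
  · rintro ⟨h1, h2⟩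
    rcases (infix_append_append_iff (h1.le.trans hk)).1 h2 with h | h
    exacts [Or.inl ⟨h1, h⟩, Or.inr ⟨h1, h⟩]
  · rintro (⟨h1, h2⟩ | ⟨h1, h2⟩)
    exacts [⟨h1, (infix_append_append_iff (h1.le.trans hk)).2 (Or.inl h2)⟩,
      ⟨h1, (infix_append_append_iff (h1.le.trans hk)).2 (Or.inr h2)⟩]

theorem factorsOfLength_append_subset {k : ℕ} {U X B : List α} {F : Set (List α)} (hX : X <:+ U)
    (hk : k ≤ X.length + 1) :
    factorsOfLength k (U ++ B) ⊆ F ↔ factorsOfLength k U ⊆ F ∧ factorsOfLength k (X ++ B) ⊆ F := by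
  rw [factorsOfLength_append hX hk, Set.union_subset_iff]

theorem suffix_append_iff_of_suffix {U X W g : List α} (hX : X <:+ U) (hl : W.length ≤ X.length) :
    W <:+ U ++ g ↔ W <:+ X ++ g := by
  have h : X ++ g <:+ U ++ g := by
    obtain ⟨A, rfl⟩ := hX
    exact ⟨A, by simp⟩
  exact ⟨fun hW => suffix_of_suffix_length_le hW h (by simp; omega), fun hW => hW.trans h⟩

theorem exists_suffix_length {n : ℕ} {u : List α} (h : n ≤ u.length) :
    ∃ X : List α, X <:+ u ∧ X.length = n :=
  ⟨u.drop (u.length - n), drop_suffix _ _, by simp; omega⟩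

theorem eq_of_suffix_of_length_eq {X Y u : List α} (hX : X <:+ u) (hY : Y <:+ u)
    (h : X.length = Y.length) : X = Y :=
  (suffix_of_suffix_length_le hX hY h.le).eq_of_length h

/-- A congruence on words for which the loops at each word `X` of length `n` (the words `g` such
that `X ++ g` ends in `X`) are idempotent and commute after `X`. -/
structure IsLocalSemilatticeCongruence (n : ℕ) (r : List α → List α → Prop) : Prop where
  equiv : Equivalence r
  append : ∀ {u v : List α} (a b : List α), r u v → r (a ++ u ++ b) (a ++ v ++ b)
  factors : ∀ {u v : List α}, r u v → factorsOfLength (n + 1) u = factorsOfLength (n + 1) v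
  idem : ∀ {X g : List α}, X.length = n → X <:+ X ++ g → r (X ++ g) (X ++ g ++ g)
  comm : ∀ {X g h : List α}, X.length = n → X <:+ X ++ g → X <:+ X ++ h →
    r (X ++ g ++ h) (X ++ h ++ g)

namespace IsLocalSemilatticeCongruence

variable {n : ℕ} {r : List α → List α → Prop} (H : IsLocalSemilatticeCongruence n r)
include H

theorem idem_append {U X g : List α} (B : List α) (hX : X.length = n) (hU : X <:+ U)
    (hg : X <:+ X ++ g) : r (U ++ g ++ B) (U ++ g ++ g ++ B) := by
  obtain ⟨A, rfl⟩ := hU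
  simpa using H.append A B (H.idem hX hg)

theorem comm_append {U X g h : List α} (B : List α) (hX : X.length = n) (hU : X <:+ U)
    (hg : X <:+ X ++ g) (hh : X <:+ X ++ h) : r (U ++ g ++ h ++ B) (U ++ h ++ g ++ B) := by
  obtain ⟨A, rfl⟩ := hU
  simpa using H.append A B (H.comm hX hg hh)

end IsLocalSemilatticeCongruence

/-- If a path of windows leads from a window of `u` to a window of `v` inside the factors of `u`
and `v`, then it passes through a common window. -/
theorem exists_common_window {n : ℕ} {u v X c : List α} (hX : X.length = n) (ρ : List α) :
    ∀ w : List α, w.length = n → (∃ B₁ B₂, v = B₁ ++ B₂ ∧ w <:+ X ++ c ++ B₁) →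
      factorsOfLength (n + 1) (w ++ ρ) ⊆
        factorsOfLength (n + 1) u ∪ factorsOfLength (n + 1) (X ++ c ++ v) →
      (c.length = 1) →
      (∀ w', w'.length = n → w' <:+ w ++ ρ → ∃ D₁ D₂, u = D₁ ++ D₂ ∧ w' <:+ D₁) →
      ∃ w' B₁ B₂ D₁ D₂, w'.length = n ∧ v = B₁ ++ B₂ ∧ w' <:+ X ++ c ++ B₁ ∧
        u = D₁ ++ D₂ ∧ w' <:+ D₁ := by
  induction ρ with
  | nil =>
    rintro w hw ⟨B₁, B₂, rfl, hB⟩ - - h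
    obtain ⟨D₁, D₂, h1, h2⟩ := h w hw (by simp)
    exact ⟨w, B₁, B₂, D₁, D₂, hw, rfl, hB, h1, h2⟩
  | cons d ρ ih =>
    rintro w hw ⟨B₁, B₂, hv, hB⟩ hF hc h
    have hmem : w ++ [d] ∈ factorsOfLength (n + 1) (w ++ d :: ρ) :=
      ⟨by simp [hw], ⟨[], ρ, by simp⟩⟩
    -- Follow the path `ρ` edge by edge: an edge of `u` starts at a window of `u`, which is then
    -- common; any other edge keeps the path among the windows of `v`.
    rcases hF hmem with ⟨-, s, t, hst⟩ | ⟨-, s, t, hst⟩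
    · exact ⟨w, B₁, B₂, s ++ w, d :: t, hw, hv, hB, by simp [← hst], suffix_append _ _⟩
    · have hsplit : X ++ c <+: s ++ (w ++ [d]) :=
        prefix_of_prefix_length_le (prefix_append _ v) ⟨t, hst⟩ (by simp; omega)
      obtain ⟨B₁', hB₁'⟩ := hsplit
      have hv' : v = B₁' ++ t := by
        rw [← hB₁', append_assoc] at hst
        exact (append_cancel_left hst).symm
      have htl : (w ++ [d]).tail <:+ w ++ [d] := tail_suffix _
      have hsuf : (w ++ [d]).tail ++ ρ <:+ w ++ d :: ρ := by
        obtain ⟨q, hq⟩ := htl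
        exact ⟨q, by rw [← append_assoc, hq]; simp⟩
      refine ih ((w ++ [d]).tail) (by simp [hw]) ⟨B₁', t, hv', ?_⟩
        ((factorsOfLength_mono hsuf.isInfix).trans hF) hc
        fun w' hw' hs => h w' hw' (hs.trans hsuf)
      rw [hB₁']
      exact htl.trans (suffix_append _ _)

namespace IsLocalSemilatticeCongruence

variable {n : ℕ} {r : List α → List α → Prop} (H : IsLocalSemilatticeCongruence n r)
include H

/-- A path `y` that starts like `x` and can return to its start inside the factors of `x` is, up to
congruence, a prefix of `x`. -/
theorem exists_append_of_return {x X₀ : List α} (hX₀ : X₀.length = n) (hx : X₀ <+: x)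
    (g : List α) : ∀ R : List α, X₀ <:+ X₀ ++ g ++ R →
      factorsOfLength (n + 1) (X₀ ++ g ++ R) ⊆ factorsOfLength (n + 1) x →
      ∃ z, r x (X₀ ++ g ++ z) := by
  induction g using List.reverseRecOn with
  | nil =>
    intro R _ _
    obtain ⟨z, rfl⟩ := hx
    exact ⟨z, by simpa using H.equiv.refl _⟩
  | append_singleton g c ih =>
    intro R hR hF
    obtain ⟨z', hz'⟩ := ih (c :: R) (by simpa using hR) (by simpa using hF)
    rw [H.factors hz'] at hF
    obtain ⟨X, hXs, hX⟩ := exists_suffix_length (n := n) (u := X₀ ++ g) (by simp; omega)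
    set y := X₀ ++ g with hy
    have hass : X₀ ++ (g ++ [c]) ++ R = y ++ [c] ++ R := by simp [hy]
    rw [hass] at hF hR
    have he : X ++ [c] ∈ factorsOfLength (n + 1) (y ++ z') := by
      refine hF ⟨by simp [hX], ?_⟩
      obtain ⟨q, hq⟩ := hXs
      exact ⟨q, R, by simp [← hq]⟩
    rw [factorsOfLength_append hXs (by omega)] at he
    rcases he with ⟨-, A, B, hAB⟩ | ⟨-, A, B, hAB⟩
    -- The edge `X c` already occurs in `y`, so `y` ends with a loop at `X` beginning with `c`;
    -- repeating this loop puts `c` after `y`.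
    · have hloop : X <:+ X ++ (c :: B) := by
        rw [← suffix_append_iff_of_suffix (suffix_append A X) le_rfl]
        simpa [← hAB] using hXs
      have h1 := H.idem_append z' hX (suffix_append A X) hloop
      refine ⟨B ++ z', H.equiv.trans hz' ?_⟩
      have e1 : A ++ X ++ c :: B = y := by simpa using hAB
      rw [e1] at h1
      simpa [hy] using h1
    -- The edge occurs only later, after a loop `z₁` at `X`. To bring `c` forward, a second loop at
    -- `X` starting with `c` is manufactured, and the two are commuted.
    · have hpre : X <+: A ++ X :=
        prefix_of_prefix_length_le (prefix_append X z') ⟨c :: B, by simpa using hAB⟩ (by simp)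
      obtain ⟨z₁, hz₁⟩ := hpre
      have hz'eq : z' = z₁ ++ [c] ++ B := by
        have : X ++ (z₁ ++ [c] ++ B) = X ++ z' := by
          rw [← hAB]; simp only [← append_assoc]; rw [hz₁]
        exact (append_cancel_left this).symm
      subst hz'eq
      have hyz : X <:+ y ++ z₁ := by
        rw [suffix_append_iff_of_suffix hXs le_rfl, hz₁]
        exact suffix_append _ _
      have hloop1 : X <:+ X ++ z₁ := by rw [hz₁]; exact suffix_append _ _
      -- the return path
      obtain ⟨w₀, hw₀s, hw₀⟩ := exists_suffix_length (n := n) (u := X ++ [c]) (by simp; omega)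
      have hcom := exists_common_window (n := n) (u := y ++ z₁) (v := B) (X := X) (c := [c]) hX
        (R ++ g) w₀ hw₀ ⟨[], B, rfl, by simpa using hw₀s⟩ ?_ rfl ?_
      · obtain ⟨w, B₁, B₂, D₁, D₂, hw, rfl, hwB, hD, hwD⟩ := hcom
        have hwD2 : X <:+ w ++ D₂ := by
          rw [← suffix_append_iff_of_suffix hwD (by omega), ← hD]; exact hyz
        have hloop2 : w <:+ w ++ (D₂ ++ [c] ++ B₁) := by
          have : w <:+ D₁ ++ (D₂ ++ [c] ++ B₁) := by
            have e : D₁ ++ (D₂ ++ [c] ++ B₁) = y ++ z₁ ++ ([c] ++ B₁) := by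
              rw [hD]; simp
            rw [e, suffix_append_iff_of_suffix hyz (by omega)]
            simpa using hwB
          rwa [suffix_append_iff_of_suffix hwD le_rfl] at this
        -- Repeating the loop at the common window `w` turns `z₁ c B₁ B₂` after `y` into `z₁ (c B₁
        -- D₂) c B₁ B₂`, where `c B₁ D₂` is a loop at `X`.
        have h1 := H.idem_append B₂ hw hwD hloop2
        have e1 : D₁ ++ (D₂ ++ [c] ++ B₁) ++ B₂ = y ++ (z₁ ++ [c] ++ (B₁ ++ B₂)) := by
          have : D₁ ++ D₂ ++ ([c] ++ B₁ ++ B₂) = y ++ z₁ ++ ([c] ++ B₁ ++ B₂) := by rw [hD]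
          simpa using this
        have e2 : D₁ ++ (D₂ ++ [c] ++ B₁) ++ (D₂ ++ [c] ++ B₁) ++ B₂ =
            y ++ z₁ ++ ([c] ++ B₁ ++ D₂) ++ ([c] ++ B₁ ++ B₂) := by
          have : D₁ ++ D₂ ++ ([c] ++ B₁ ++ D₂ ++ [c] ++ B₁ ++ B₂) =
            y ++ z₁ ++ ([c] ++ B₁ ++ D₂ ++ [c] ++ B₁ ++ B₂) := by rw [hD]
          simpa using this
        rw [e1, e2] at h1
        have hloop3 : X <:+ X ++ ([c] ++ B₁ ++ D₂) := by
          have : X <:+ (X ++ [c] ++ B₁) ++ D₂ := by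
            rw [suffix_append_iff_of_suffix hwB (by omega)]; exact hwD2
          simpa using this
        have h2 := H.comm_append ([c] ++ B₁ ++ B₂) hX hXs hloop1 hloop3
        refine ⟨B₁ ++ D₂ ++ z₁ ++ ([c] ++ B₁ ++ B₂), H.equiv.trans hz' (H.equiv.trans h1 ?_)⟩
        simpa [hy] using h2
      · have e : y ++ [c] ++ (R ++ g) = y ++ [c] ++ R ++ g := by simp
        have h1 : factorsOfLength (n + 1) (y ++ [c] ++ (R ++ g)) ⊆
            factorsOfLength (n + 1) (y ++ (z₁ ++ [c] ++ B)) := by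
          rw [e, factorsOfLength_append_subset hR (by omega)]
          exact ⟨hF, (factorsOfLength_mono (prefix_append y _).isInfix)⟩
        have h2 : w₀ ++ (R ++ g) <:+: y ++ [c] ++ (R ++ g) := by
          have : w₀ <:+ y ++ [c] := by
            rw [suffix_append_iff_of_suffix hXs (by omega)]; exact hw₀s
          obtain ⟨q, hq⟩ := this
          exact ⟨q, [], by simp only [append_nil, ← append_assoc]; rw [hq]⟩
        refine (factorsOfLength_mono h2).trans (h1.trans ?_)
        have e3 : y ++ (z₁ ++ [c] ++ B) = (y ++ z₁) ++ ([c] ++ B) := by simp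
        rw [e3, factorsOfLength_append hyz (by omega)]
        simp
      -- The return path ends at `X`: `R` leads back to `X₀`, and `g` leads from `X₀` to `X`.
      · intro w' hw' hs
        have : w' = X := by
          refine eq_of_suffix_of_length_eq (u := y ++ [c] ++ R ++ g) ?_ ?_ (by omega)
          · have hw1 : w₀ <:+ y ++ [c] := by
              rw [suffix_append_iff_of_suffix hXs (by omega)]; exact hw₀s
            have := (suffix_append_iff_of_suffix (g := R ++ g) hw1 (by omega : w'.length ≤ _)).2 hs
            simpa using this
          · rw [suffix_append_iff_of_suffix hR (by omega)]; exact hXs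
        exact ⟨y ++ z₁, [], by simp, this ▸ hyz⟩

/-- A loop at the start of `x` whose factors are factors of `x` can be inserted. -/
theorem insert_loop {X₀ x l : List α} (hX₀ : X₀.length = n) (hl : X₀ <:+ X₀ ++ l)
    (hF : factorsOfLength (n + 1) (X₀ ++ l) ⊆ factorsOfLength (n + 1) (X₀ ++ x)) :
    r (X₀ ++ x) (X₀ ++ l ++ x) := by
  obtain ⟨z, hz⟩ := H.exists_append_of_return hX₀ (prefix_append X₀ x) l [] (by simpa using hl)
    (by simpa using hF)
  have h1 := H.idem_append z hX₀ (suffix_refl X₀) hl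
  obtain ⟨A, hA⟩ := hl
  have h2 : r (X₀ ++ l ++ x) (X₀ ++ l ++ l ++ z) := by
    rw [← hA]
    simpa using H.append A [] hz
  exact H.equiv.trans hz (H.equiv.trans h1 (H.equiv.symm h2))

/-- With a return path `R`, both `xR` and `yR` are insertable loops at `X₀`. After `X₀`, this gives
`x ~ yRx ~ yRyRx ~ yRxRy ~ xRy ~ y`, where the middle step commutes the loops `Ry` and `Rx` at `X`.
-/
theorem of_strongly_connected {X₀ X x y R : List α} (hX₀ : X₀.length = n) (hX : X.length = n)
    (hx : X <:+ X₀ ++ x) (hy : X <:+ X₀ ++ y)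
    (hF : factorsOfLength (n + 1) (X₀ ++ x) = factorsOfLength (n + 1) (X₀ ++ y))
    (hR : X₀ <:+ X ++ R)
    (hFR : factorsOfLength (n + 1) (X ++ R) ⊆ factorsOfLength (n + 1) (X₀ ++ x)) :
    r (X₀ ++ x) (X₀ ++ y) := by
  have lx : X₀ <:+ X₀ ++ (x ++ R) := by
    rw [← append_assoc, suffix_append_iff_of_suffix hx (by omega)]; exact hR
  have ly : X₀ <:+ X₀ ++ (y ++ R) := by
    rw [← append_assoc, suffix_append_iff_of_suffix hy (by omega)]; exact hR
  have Fx : factorsOfLength (n + 1) (X₀ ++ (x ++ R)) ⊆ factorsOfLength (n + 1) (X₀ ++ x) := by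
    rw [← append_assoc, factorsOfLength_append_subset hx (by omega)]; exact ⟨subset_rfl, hFR⟩
  have Fy : factorsOfLength (n + 1) (X₀ ++ (y ++ R)) ⊆ factorsOfLength (n + 1) (X₀ ++ x) := by
    rw [← append_assoc, factorsOfLength_append_subset hy (by omega)]; exact ⟨hF.ge, hFR⟩
  have a1 := H.insert_loop hX₀ ly Fy
  have a2 := H.insert_loop hX₀ lx (Fx.trans hF.le)
  have a3 := H.insert_loop hX₀ ly (Fy.trans hF.le)
  have loop : ∀ t, X <:+ X₀ ++ t → X <:+ X ++ (R ++ t) := fun t ht => by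
    rw [← append_assoc, suffix_append_iff_of_suffix hR (by omega)]; exact ht
  have c1 : r (X₀ ++ y ++ (R ++ y) ++ (R ++ x)) (X₀ ++ y ++ (R ++ x) ++ (R ++ y)) := by
    simpa using H.comm_append [] hX hy (loop y hy) (loop x hx)
  have b1 : r (X₀ ++ y ++ R ++ x) (X₀ ++ y ++ (R ++ y) ++ (R ++ x)) := by
    simpa using H.append [] (R ++ x) a3
  have b2 : r (X₀ ++ x ++ (R ++ y)) (X₀ ++ y ++ (R ++ x) ++ (R ++ y)) := by
    simpa using H.append [] (R ++ y) a1
  have a1' : r (X₀ ++ x) (X₀ ++ y ++ R ++ x) := by simpa using a1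
  have a2' : r (X₀ ++ y) (X₀ ++ x ++ (R ++ y)) := by simpa using a2
  have tr := @H.equiv.trans
  have sy := @H.equiv.symm
  exact tr a1' (tr b1 (tr c1 (tr (sy b2) (sy a2'))))

end IsLocalSemilatticeCongruence

end List

/-! ### Simon's theorem: cutting walks at edges of no return -/

namespace List

variable {α : Type u}

theorem factorsOfLength_succ_self {n : ℕ} {Z : List α} {c : α} (hZ : Z.length = n) :
    factorsOfLength (n + 1) (Z ++ [c]) = {Z ++ [c]} := by
  ext f
  constructor
  · rintro ⟨h1, h2⟩
    exact h2.eq_of_length (by simp [h1, hZ])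
  · rintro rfl
    exact ⟨by simp [hZ], infix_rfl⟩

theorem factorsOfLength_eq_empty {k : ℕ} {u : List α} (h : u.length < k) :
    factorsOfLength k u = ∅ := by
  ext f
  refine ⟨fun hf => ?_, fun hf => hf.elim⟩
  have := hf.2.length_le
  have := hf.1
  omega

/-- A path of windows that leaves a set of windows has a first edge leaving it. -/
theorem exists_exit {n : ℕ} {p : List α → Prop} {X : List α} (hX : X.length = n) (hpX : ¬ p X)
    (x : List α) : ∀ X₀ : List α, X₀.length = n → X <:+ X₀ ++ x → p X₀ →
      ∃ x₁ c x₂ Z W, x = x₁ ++ c :: x₂ ∧ Z.length = n ∧ W.length = n ∧ Z <:+ X₀ ++ x₁ ∧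
        W <:+ Z ++ [c] ∧ p Z ∧ ¬ p W := by
  induction x with
  | nil =>
    intro X₀ hX₀ hs hp
    rw [append_nil] at hs
    exact absurd (hs.eq_of_length (by omega) ▸ hp) hpX
  | cons c x ih =>
    intro X₀ hX₀ hs hp
    have htl : (X₀ ++ [c]).tail <:+ X₀ ++ [c] := tail_suffix _
    have hlen : (X₀ ++ [c]).tail.length = n := by simp [hX₀]
    by_cases h : p (X₀ ++ [c]).tail
    · have e : X₀ ++ c :: x = X₀ ++ [c] ++ x := by simp
      rw [e, suffix_append_iff_of_suffix htl (by omega)] at hs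
      obtain ⟨x₁, d, x₂, Z, W, rfl, hZ, hW, hZs, hWs, hpZ, hpW⟩ := ih _ hlen hs h
      refine ⟨c :: x₁, d, x₂, Z, W, rfl, hZ, hW, ?_, hWs, hpZ, hpW⟩
      have e' : X₀ ++ c :: x₁ = X₀ ++ [c] ++ x₁ := by simp
      rw [e', suffix_append_iff_of_suffix htl (by omega)]
      exact hZs
    · exact ⟨[], c, x, X₀, _, rfl, hX₀, hlen, by simp, htl, hp, h⟩

/-- The window `w` can return to the window `X₀` inside the set `F` of factors. -/
def Returns (n : ℕ) (X₀ : List α) (F : Set (List α)) (w : List α) : Prop :=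
  ∃ R, X₀ <:+ w ++ R ∧ factorsOfLength (n + 1) (w ++ R) ⊆ F

namespace Returns

variable {n : ℕ} {X₀ : List α} {F : Set (List α)} {w w' t f U Z W v : List α} {c : α}

theorem of_path (hw : w.length = n) (hX₀ : X₀.length = n) (hs : w <:+ w' ++ t)
    (hF : factorsOfLength (n + 1) (w' ++ t) ⊆ F) (h : Returns n X₀ F w) : Returns n X₀ F w' := by
  obtain ⟨R, h1, h2⟩ := h
  refine ⟨t ++ R, ?_, ?_⟩
  · rw [← append_assoc, suffix_append_iff_of_suffix hs (by omega)]; exact h1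
  · rw [← append_assoc, factorsOfLength_append_subset hs (by omega)]; exact ⟨hF, h2⟩

/-- A factor `f` of length `n + 1` is an edge and `f.tail` its end window; the rest of `U` leads
from there to `Z`. -/
theorem tail_of_mem (hX₀ : X₀.length = n) (hZ : Z.length = n) (hU : Z <:+ U)
    (hF : factorsOfLength (n + 1) U ⊆ F) (hf : f ∈ factorsOfLength (n + 1) U)
    (h : Returns n X₀ F Z) : Returns n X₀ F f.tail := by
  obtain ⟨hl, s, t, rfl⟩ := hf
  have hfl : f.tail.length = n := by simp [hl]
  have h1 : f.tail <:+ s ++ f := (tail_suffix f).trans (suffix_append s f)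
  refine of_path hZ hX₀ (t := t) ?_ ((factorsOfLength_mono ?_).trans hF) h
  · rwa [suffix_append_iff_of_suffix h1 (by omega)] at hU
  · obtain ⟨q, hq⟩ := h1
    exact ⟨q, [], by simp only [append_nil, ← append_assoc]; rw [hq]⟩

/-- The window `W` after the first edge `Z c` is at or before the end of every edge of the word, so
it inherits any return. -/
theorem of_mem_tail (hX₀ : X₀.length = n) (hZ : Z.length = n) (hW : W.length = n)
    (hWZ : W <:+ Z ++ [c]) (hF : factorsOfLength (n + 1) (Z ++ [c] ++ v) ⊆ F)
    (hf : f ∈ factorsOfLength (n + 1) (Z ++ [c] ++ v)) (h : Returns n X₀ F f.tail) :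
    Returns n X₀ F W := by
  obtain ⟨hl, s, t, hst⟩ := hf
  have hp : Z ++ [c] <+: s ++ f :=
    prefix_of_prefix_length_le (prefix_append _ v) ⟨t, hst⟩ (by simp; omega)
  obtain ⟨v₁, hv₁⟩ := hp
  refine of_path (w := f.tail) (by simp [hl]) hX₀ (t := v₁) ?_
    ((factorsOfLength_mono ?_).trans hF) h
  · rw [← suffix_append_iff_of_suffix hWZ (by simp [hl, hW]), hv₁]
    exact (tail_suffix f).trans (suffix_append s f)
  · rw [← hst, ← hv₁]
    obtain ⟨q, hq⟩ := hWZ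
    exact ⟨q, t, by rw [← hq]; simp⟩

/-- If the edge `Z c` occurs in a walk from `W`, then `W` leads back to `Z`. Hence an edge of no
return is used only once. -/
theorem of_mem_edge (hX₀ : X₀.length = n) (hZ : Z.length = n) (hW : W.length = n)
    (hF : factorsOfLength (n + 1) (W ++ v) ⊆ F)
    (hf : Z ++ [c] ∈ factorsOfLength (n + 1) (W ++ v)) (h : Returns n X₀ F Z) :
    Returns n X₀ F W := by
  obtain ⟨-, s, t, hst⟩ := hf
  have hp : W <+: s ++ Z :=
    prefix_of_prefix_length_le (prefix_append _ v) ⟨c :: t, by simpa using hst⟩ (by simp; omega)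
  obtain ⟨v₁, hv₁⟩ := hp
  refine of_path hZ hX₀ (t := v₁) (by rw [hv₁]; exact suffix_append _ _)
    ((factorsOfLength_mono ?_).trans hF) h
  rw [hv₁, ← hst]
  exact ⟨[], c :: t, by simp⟩

end Returns

/-- Words of length at least `n` with the same prefix and suffix of length `n` and the same factors
of length `n + 1` are congruent (Simon). -/
theorem IsLocalSemilatticeCongruence.of_same_factors {n : ℕ} {r : List α → List α → Prop}
    (H : IsLocalSemilatticeCongruence n r) {X : List α} (hX : X.length = n) (N : ℕ) :
    ∀ X₀ x y : List α, x.length < N → X₀.length = n → X <:+ X₀ ++ x → X <:+ X₀ ++ y →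
      factorsOfLength (n + 1) (X₀ ++ x) = factorsOfLength (n + 1) (X₀ ++ y) →
      r (X₀ ++ x) (X₀ ++ y) := by
  induction N with
  | zero => intro _ _ _ h; omega
  | succ N ih =>
    intro X₀ x y hN hX₀ hx hy hF
    set F := factorsOfLength (n + 1) (X₀ ++ x) with hFdef
    by_cases hret : Returns n X₀ F X
    · obtain ⟨R, hR, hFR⟩ := hret
      exact H.of_strongly_connected hX₀ hX hx hy hF hR hFR
    have hret₀ : Returns n X₀ F X₀ :=
      ⟨[], by simp, by rw [append_nil, factorsOfLength_eq_empty (by omega)]; exact Set.empty_subset _⟩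
    -- Cut at the first edge whose end cannot return to `X₀`. The part before it is strongly
    -- connected; the part after it is shorter and falls to the induction hypothesis.
    obtain ⟨x₁, c, x₂, Z, W, rfl, hZ, hW, hZs, hWs, hpZ, hpW⟩ :=
      exists_exit (p := Returns n X₀ F) hX hret x X₀ hX₀ hx hret₀
    -- splitting at the edge `Z c` separates the factors that can return from the others
    have key : ∀ y₁ y₂ : List α, Z <:+ X₀ ++ y₁ →
        factorsOfLength (n + 1) (X₀ ++ (y₁ ++ c :: y₂)) = F →
        factorsOfLength (n + 1) (X₀ ++ y₁) = {f ∈ F | Returns n X₀ F f.tail} ∧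
        factorsOfLength (n + 1) (W ++ y₂) =
          {f ∈ F | ¬ Returns n X₀ F f.tail ∧ f ≠ Z ++ [c]} := by
      intro y₁ y₂ hy₁ hFy
      have e1 : X₀ ++ (y₁ ++ c :: y₂) = X₀ ++ y₁ ++ ([c] ++ y₂) := by simp
      have u1 : F = factorsOfLength (n + 1) (X₀ ++ y₁) ∪
          factorsOfLength (n + 1) (Z ++ [c] ++ y₂) := by
        rw [← hFy, e1, factorsOfLength_append hy₁ (by omega), append_assoc]
      have u2 : factorsOfLength (n + 1) (Z ++ [c] ++ y₂) =
          {Z ++ [c]} ∪ factorsOfLength (n + 1) (W ++ y₂) := by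
        rw [factorsOfLength_append hWs (by omega), factorsOfLength_succ_self hZ]
      have s1 : factorsOfLength (n + 1) (X₀ ++ y₁) ⊆ F := by rw [u1]; exact Set.subset_union_left
      have s2 : factorsOfLength (n + 1) (Z ++ [c] ++ y₂) ⊆ F := by
        rw [u1]; exact Set.subset_union_right
      have s3 : factorsOfLength (n + 1) (W ++ y₂) ⊆ F := by
        refine Set.Subset.trans ?_ s2
        rw [u2]; exact Set.subset_union_right
      have g1 : ∀ f ∈ factorsOfLength (n + 1) (X₀ ++ y₁), Returns n X₀ F f.tail :=
        fun f hf => Returns.tail_of_mem hX₀ hZ hy₁ s1 hf hpZ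
      have g2 : ∀ f ∈ factorsOfLength (n + 1) (Z ++ [c] ++ y₂), ¬ Returns n X₀ F f.tail :=
        fun f hf h => hpW (Returns.of_mem_tail hX₀ hZ hW hWs s2 hf h)
      have g3 : Z ++ [c] ∉ factorsOfLength (n + 1) (W ++ y₂) :=
        fun hf => hpW (Returns.of_mem_edge hX₀ hZ hW s3 hf hpZ)
      constructor
      · ext f
        refine ⟨fun hf => ⟨s1 hf, g1 f hf⟩, fun ⟨hf, hr⟩ => ?_⟩
        rw [u1] at hf
        exact hf.resolve_right fun h => g2 f h hr
      · ext f
        refine ⟨fun hf => ⟨s3 hf, g2 f (u2 ▸ Or.inr hf), fun h => g3 (h ▸ hf)⟩,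
          fun ⟨hf, hr, hne⟩ => ?_⟩
        rw [u1] at hf
        rcases hf with hf | hf
        · exact absurd (g1 f hf) hr
        · rw [u2] at hf
          exact hf.resolve_left hne
    -- the word `y` passes through the same edge
    have he : Z ++ [c] ∈ factorsOfLength (n + 1) (X₀ ++ y) := by
      rw [← hF, hFdef]
      refine ⟨by simp [hZ], ?_⟩
      obtain ⟨q, hq⟩ := hZs
      exact ⟨q, x₂, by
        have : q ++ Z ++ ([c] ++ x₂) = X₀ ++ x₁ ++ ([c] ++ x₂) := by rw [hq]
        simpa using this⟩
    obtain ⟨-, A, y₂, hA⟩ := he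
    have hpre : X₀ <+: A ++ Z :=
      prefix_of_prefix_length_le (prefix_append X₀ y) ⟨c :: y₂, by simpa using hA⟩ (by simp; omega)
    obtain ⟨y₁, hy₁⟩ := hpre
    have hyeq : y = y₁ ++ c :: y₂ := by
      have : X₀ ++ (y₁ ++ c :: y₂) = X₀ ++ y := by
        rw [← hA, ← append_assoc, hy₁]; simp
      exact (append_cancel_left this).symm
    subst hyeq
    have hZy : Z <:+ X₀ ++ y₁ := by rw [hy₁]; exact suffix_append _ _
    obtain ⟨kx1, kx2⟩ := key x₁ x₂ hZs rfl
    obtain ⟨ky1, ky2⟩ := key y₁ y₂ hZy hF.symm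
    obtain ⟨R, hR, hFR⟩ := id hpZ
    have r1 : r (X₀ ++ x₁) (X₀ ++ y₁) := by
      refine H.of_strongly_connected hX₀ hZ hZs hZy (by rw [kx1, ky1]) hR ?_
      rw [kx1]
      exact fun f hf => ⟨hFR hf, Returns.tail_of_mem hX₀ hX₀ hR hFR hf hret₀⟩
    have split : ∀ z₁ z₂ : List α, X₀ ++ (z₁ ++ c :: z₂) = X₀ ++ z₁ ++ [c] ++ z₂ := by simp
    have hWend : ∀ z₁ : List α, Z <:+ X₀ ++ z₁ → W <:+ X₀ ++ z₁ ++ [c] := fun z₁ hz => by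
      rw [suffix_append_iff_of_suffix hz (by omega)]; exact hWs
    have r2 : r (W ++ x₂) (W ++ y₂) := by
      refine ih W x₂ y₂ (by simp at hN; omega) hW ?_ ?_ (by rw [kx2, ky2])
      · rwa [split, suffix_append_iff_of_suffix (hWend x₁ hZs) (by omega)] at hx
      · rwa [split, suffix_append_iff_of_suffix (hWend y₁ hZy) (by omega)] at hy
    have r3 : r (X₀ ++ (x₁ ++ c :: x₂)) (X₀ ++ y₁ ++ [c] ++ x₂) := by
      simpa using H.append [] (c :: x₂) r1
    obtain ⟨q, hq⟩ := hWend y₁ hZy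
    have r4 := H.append q [] r2
    simp only [append_nil, ← append_assoc, hq] at r4
    rw [split y₁ y₂]
    exact H.equiv.trans r3 r4

end List

/-! ### Test data as a congruence on words -/

open List in
theorem sameTestData_succ_iff {α : Type u} {n : ℕ} {u v : List α} :
    SameTestData (n + 1) u v ↔ u = v ∨ ∃ X Y : List α, X.length = n ∧ Y.length = n ∧
      X <+: u ∧ X <+: v ∧ Y <:+ u ∧ Y <:+ v ∧
      factorsOfLength (n + 1) u = factorsOfLength (n + 1) v := by
  constructor
  · rintro ⟨h1, h2, h3⟩
    simp only [Nat.add_sub_cancel] at h1 h2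
    have hl := congrArg length h1
    simp only [length_take] at hl
    by_cases hu : u.length < n
    · left
      rw [take_of_length_le (by omega), take_of_length_le (by omega)] at h1
      exact h1
    · refine Or.inr ⟨u.take n, u.rtake n, by simp; omega, by simp [rtake]; omega, take_prefix _ _,
        h1 ▸ take_prefix _ _, drop_suffix _ _, ?_, h3⟩
      rw [h2]; exact drop_suffix _ _
  · rintro (rfl | ⟨X, Y, hX, hY, h1, h2, h3, h4, h5⟩)
    · exact ⟨rfl, rfl, rfl⟩
    · refine ⟨?_, ?_, h5⟩
      · simp only [Nat.add_sub_cancel, ← hX]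
        rw [← prefix_iff_eq_take.1 h1, ← prefix_iff_eq_take.1 h2]
      · simp only [Nat.add_sub_cancel, ← hY, rtake]
        rw [← suffix_iff_eq_drop.1 h3, ← suffix_iff_eq_drop.1 h4]

namespace SameTestData

open List

variable {α : Type u} {k n : ℕ} {u v : List α}

theorem append (hk : 0 < k) (h : SameTestData k u v) (a b : List α) :
    SameTestData k (a ++ u ++ b) (a ++ v ++ b) := by
  obtain ⟨n, rfl⟩ : ∃ n, k = n + 1 := ⟨k - 1, by omega⟩
  rw [sameTestData_succ_iff] at h ⊢
  rcases h with rfl | ⟨X, Y, hX, hY, h1, h2, h3, h4, h5⟩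
  · exact Or.inl rfl
  have hpre : ∀ w : List α, X <+: w → a ++ X <+: a ++ w ++ b := by
    rintro w ⟨t, rfl⟩
    exact ⟨t ++ b, by simp⟩
  have hsuf : ∀ w : List α, Y <:+ w → Y ++ b <:+ a ++ w ++ b := by
    rintro w ⟨t, rfl⟩
    exact ⟨a ++ t, by simp⟩
  have hfac : ∀ w : List α, X <+: w → Y <:+ w → factorsOfLength (n + 1) (a ++ w ++ b) =
      factorsOfLength (n + 1) (a ++ X) ∪ factorsOfLength (n + 1) w ∪
        factorsOfLength (n + 1) (Y ++ b) := by
    intro w hw hw'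
    rw [factorsOfLength_append (hw'.trans (suffix_append a w)) (by omega)]
    obtain ⟨t, rfl⟩ := hw
    rw [← append_assoc a X t, factorsOfLength_append (suffix_append a X) (by omega)]
  refine Or.inr ⟨(a ++ X).take n, (Y ++ b).rtake n, by simp; omega, by simp [rtake]; omega,
    (take_prefix _ _).trans (hpre u h1), (take_prefix _ _).trans (hpre v h2),
    (drop_suffix _ _).trans (hsuf u h3), (drop_suffix _ _).trans (hsuf v h4), ?_⟩
  rw [hfac u h1 h3, hfac v h2 h4, h5]

/-- A factor of length `k` either extends by a letter to the right, or is the suffix of length `k`,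
which the data of order `k + 1` record. -/
theorem of_succ (hk : 0 < k) (h : SameTestData (k + 1) u v) : SameTestData k u v := by
  obtain ⟨n, rfl⟩ : ∃ n, k = n + 1 := ⟨k - 1, by omega⟩
  rw [sameTestData_succ_iff] at h ⊢
  rcases h with rfl | ⟨X, Y, hX, hY, h1, h2, h3, h4, h5⟩
  · exact Or.inl rfl
  have key : ∀ u v : List α, Y <:+ u → Y <:+ v →
      factorsOfLength (n + 1 + 1) u = factorsOfLength (n + 1 + 1) v →
      factorsOfLength (n + 1) u ⊆ factorsOfLength (n + 1) v := by
    rintro u v hu hv huv f ⟨hf, s, t, rfl⟩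
    cases t with
    | nil =>
      rw [append_nil] at hu
      have := eq_of_suffix_of_length_eq hu (suffix_append s f) (by omega)
      exact ⟨hf, this ▸ hv.isInfix⟩
    | cons c t =>
      have : f ++ [c] ∈ factorsOfLength (n + 1 + 1) v := by
        rw [← huv]
        exact ⟨by simp [hf], s, t, by simp⟩
      exact ⟨hf, (prefix_append f [c]).isInfix.trans this.2⟩
  exact Or.inr ⟨X.take n, Y.rtake n, by simp; omega, by simp [rtake]; omega,
    (take_prefix _ _).trans h1, (take_prefix _ _).trans h2,
    (drop_suffix _ _).trans h3, (drop_suffix _ _).trans h4,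
    (key u v h3 h4 h5).antisymm (key v u h4 h3 h5.symm)⟩

/-- Two words that start and end with a word `X` of length at least `k - 1` have the same test data
if they have the same factors. -/
theorem of_factors (hk : 0 < k) {X : List α} (hX : k ≤ X.length + 1) (hu : X <+: u) (hv : X <+: v)
    (hu' : X <:+ u) (hv' : X <:+ v) (h : factorsOfLength k u = factorsOfLength k v) :
    SameTestData k u v := by
  obtain ⟨n, rfl⟩ : ∃ n, k = n + 1 := ⟨k - 1, by omega⟩
  rw [sameTestData_succ_iff]
  exact Or.inr ⟨X.take n, X.rtake n, by simp; omega, by simp [rtake]; omega,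
    (take_prefix _ _).trans hu, (take_prefix _ _).trans hv,
    (drop_suffix _ _).trans hu', (drop_suffix _ _).trans hv', h⟩

theorem swap (hk : 0 < k) {X : List α} (hX : k ≤ X.length + 1) (y z : List α) :
    SameTestData k (X ++ y ++ X ++ z ++ X) (X ++ z ++ X ++ y ++ X) := by
  refine of_factors hk hX ⟨y ++ X ++ z ++ X, by simp⟩ ⟨z ++ X ++ y ++ X, by simp⟩
    (suffix_append _ _) (suffix_append _ _) ?_
  have h : ∀ y z : List α, factorsOfLength k (X ++ y ++ X ++ z ++ X) =
      factorsOfLength k (X ++ y ++ X) ∪ factorsOfLength k (X ++ z ++ X) := by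
    intro y z
    rw [append_assoc _ z X, factorsOfLength_append (suffix_append (X ++ y) X) hX, append_assoc X z]
  rw [h, h, Set.union_comm]

theorem duplicate (hk : 0 < k) {X : List α} (hX : k ≤ X.length + 1) (y : List α) :
    SameTestData k (X ++ y ++ X) (X ++ y ++ X ++ y ++ X) := by
  refine of_factors hk hX ⟨y ++ X, by simp⟩ ⟨y ++ X ++ y ++ X, by simp⟩
    (suffix_append _ _) (suffix_append _ _) ?_
  rw [append_assoc (X ++ y ++ X) y X, factorsOfLength_append (suffix_append (X ++ y) X) hX,
    ← append_assoc X y X, Set.union_self]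

end SameTestData

theorem IsTestableLanguage.mono {α : Type u} {L : Language α} {j k : ℕ} (hjk : j ≤ k)
    (h : IsTestableLanguage j L) : IsTestableLanguage k L := by
  induction hjk with
  | refl => exact h
  | step _ ih =>
    exact ⟨Nat.succ_pos _, fun u v hu hv huv => ih.2 u v hu hv (huv.of_succ ih.1)⟩

/-! ### The identity of testability on words over generators -/

section Generators

open List

variable {A : Type v} {S : Type u} [Semigroup S]

/-- The value of a word over generators of a semigroup, in the semigroup with a unit adjoined. -/
def wordValue (g : A → S) (w : List A) : WithOne S := (w.map fun a => (g a : WithOne S)).prod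

theorem wordValue_append (g : A → S) (u v : List A) :
    wordValue g (u ++ v) = wordValue g u * wordValue g v := by simp [wordValue]

theorem exists_coe_eq_wordValue (g : A → S) {w : List A} (hw : w ≠ []) :
    ∃ s : S, (s : WithOne S) = wordValue g w := by
  induction w with
  | nil => exact absurd rfl hw
  | cons a w ih =>
    by_cases h : w = []
    · exact ⟨g a, by simp [wordValue, h]⟩
    · obtain ⟨s, hs⟩ := ih h
      exact ⟨g a * s, by simp [wordValue, hs]⟩

/-- A semigroup satisfies the identity of `n`-testability if words over some generators with the
same test data have the same value. -/
theorem satisfiesBeta_of_wordValue {n : ℕ} (hn : 0 < n) (g : A → S)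
    (hg : ∀ s : S, ∃ w : List A, w ≠ [] ∧ (s : WithOne S) = wordValue g w)
    (h : ∀ u v : List A, u ≠ [] → v ≠ [] → SameTestData n u v → wordValue g u = wordValue g v) :
    SatisfiesBeta n S := by
  intro x y z
  -- Each element is the value of a nonempty word, so the block in the identity is represented by a
  -- word of length at least `n - 1`, long enough for `SameTestData.swap`.
  have hprod : ∀ l : List S, ∃ X : List A, l.length ≤ X.length ∧
      (l.map fun s : S => (s : WithOne S)).prod = wordValue g X := by
    intro l
    induction l with
    | nil => exact ⟨[], le_rfl, by simp [wordValue]⟩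
    | cons s l ih =>
      obtain ⟨X, hX, hX'⟩ := ih
      obtain ⟨w, hw, hw'⟩ := hg s
      have := length_pos_of_ne_nil hw
      exact ⟨w ++ X, by simp; omega, by rw [wordValue_append, ← hw', ← hX']; simp⟩
  obtain ⟨X, hX, hX'⟩ := hprod (ofFn x)
  obtain ⟨wy, hy, hy'⟩ := hg y
  obtain ⟨wz, hz, hz'⟩ := hg z
  have e : (ofFn fun i => (x i : WithOne S)).prod = wordValue g X := by
    rw [← hX', map_ofFn]; rfl
  simp only [e, hy', hz', ← wordValue_append]
  refine h _ _ (by simp [hy]) (by simp [hy]) (SameTestData.swap hn ?_ _ _)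
  simp only [length_ofFn] at hX
  omega

theorem SatisfiesBeta.wordValue {n : ℕ} (h : SatisfiesBeta n S) (g : A → S) {X y z : List A}
    (hX : X.length = n - 1) (hy : y ≠ []) (hz : z ≠ []) :
    wordValue g (X ++ y ++ X ++ z ++ X) = wordValue g (X ++ z ++ X ++ y ++ X) := by
  obtain ⟨f, rfl⟩ : ∃ f : Fin (n - 1) → A, X = ofFn f :=
    ⟨fun i => X[i], by
      apply ext_getElem <;> simp [hX]⟩
  obtain ⟨s, hs⟩ := exists_coe_eq_wordValue g hy
  obtain ⟨t, ht⟩ := exists_coe_eq_wordValue g hz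
  have := h (fun i => g (f i)) s t
  simp only [hs, ht] at this
  have e : (ofFn fun i => (g (f i) : WithOne S)).prod = _root_.wordValue g (ofFn f) := by
    rw [_root_.wordValue, map_ofFn]; rfl
  simpa only [e, ← wordValue_append] using this

theorem IsTestableSemigroup.satisfiesBeta {n : ℕ} (h : IsTestableSemigroup n S) :
    SatisfiesBeta n S := by
  obtain ⟨hn, A, φ, hφ, h⟩ := h
  have key : ∀ (t : List A) (a : A),
      (φ ⟨a, t⟩ : WithOne S) = wordValue (fun a => φ (FreeSemigroup.of a)) (a :: t) := by
    intro t
    induction t with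
    | nil => intro a; simp [wordValue]; rfl
    | cons b t ih =>
      intro a
      have e : (⟨a, b :: t⟩ : FreeSemigroup A) = FreeSemigroup.of a * ⟨b, t⟩ := rfl
      rw [e, map_mul, WithOne.coe_mul, ih b]
      simp [wordValue]
  refine satisfiesBeta_of_wordValue hn (fun a => φ (FreeSemigroup.of a)) (fun s => ?_) ?_
  · obtain ⟨w, rfl⟩ := hφ s
    exact ⟨w.head :: w.tail, by simp, key w.tail w.head⟩
  · intro u v hu hv huv
    obtain ⟨a, u, rfl⟩ := exists_cons_of_ne_nil hu
    obtain ⟨b, v, rfl⟩ := exists_cons_of_ne_nil hv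
    rw [← key, ← key, h ⟨a, u⟩ ⟨b, v⟩ huv]

end Generators

/-! ### Runs and the transition semigroup -/

namespace PartialDFA

open List

variable {α : Type u} {σ : Type v} {M : PartialDFA α σ}

@[simp] theorem run_nil (p : σ) : M.run p [] = some p := rfl

theorem run_cons (p : σ) (a : α) (w : List α) :
    M.run p (a :: w) = (M.step p a).bind fun q => M.run q w := rfl

theorem run_append (p : σ) (u v : List α) :
    M.run p (u ++ v) = (M.run p u).bind fun q => M.run q v := by
  induction u generalizing p with
  | nil => simp
  | cons a u ih => simp only [cons_append, run_cons, ih, Option.bind_assoc]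

theorem run_append_of_eq {p q : σ} {u : List α} (h : M.run p u = some q) (v : List α) :
    M.run p (u ++ v) = M.run q v := by simp [run_append, h]

theorem run_append_eq_some {p r : σ} {u v : List α} :
    M.run p (u ++ v) = some r ↔ ∃ q, M.run p u = some q ∧ M.run q v = some r := by
  simp [run_append, Option.bind_eq_some_iff]

theorem run_singleton (p : σ) (a : α) : M.run p [a] = M.step p a := by simp [run_cons]

@[refl] theorem Reaches.refl (p : σ) : M.Reaches p p := ⟨[], rfl⟩

theorem Reaches.trans {p q r : σ} (h : M.Reaches p q) (h' : M.Reaches q r) : M.Reaches p r := by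
  obtain ⟨u, hu⟩ := h
  obtain ⟨v, hv⟩ := h'
  exact ⟨u ++ v, by rw [run_append_of_eq hu, hv]⟩

theorem Reaches.of_step {p q : σ} {a : α} (h : M.step p a = some q) : M.Reaches p q :=
  ⟨[a], by rw [run_singleton, h]⟩

/-! ### The action of words with the same test data -/

variable (M) in
/-- Nonempty words with the same test data act in the same way on the states. -/
def RunTestable (k : ℕ) : Prop :=
  0 < k ∧ ∀ u v : List α, u ≠ [] → v ≠ [] → SameTestData k u v → ∀ p, M.run p u = M.run p v

theorem IsTestable.runTestable {k : ℕ} (hred : M.IsReduced) (h : M.IsTestable k) :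
    M.RunTestable k := by
  refine ⟨h.1, fun u v hu hv huv p => ?_⟩
  obtain ⟨a, ha⟩ := hred.1 p
  have := hred.2 (a ++ u) (a ++ v) fun w =>
    h.2 _ _ (by simp [hu]) (by simp [hv]) (huv.append h.1 a w)
  rwa [run_append_of_eq ha, run_append_of_eq ha] at this

theorem RunTestable.isTestable {k : ℕ} (h : M.RunTestable k) : M.IsTestable k := by
  refine ⟨h.1, fun u v hu hv huv => ?_⟩
  change (∃ q ∈ M.accept, M.run M.start u = some q) ↔ ∃ q ∈ M.accept, M.run M.start v = some q
  rw [h.2 u v hu hv huv]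

variable (M) in
/-- The action of a letter as an element of the transition semigroup. -/
def letterAction (a : α) : M.transitionSemigroup :=
  ⟨fun p => M.step p a, Subsemigroup.subset_closure ⟨a, rfl⟩⟩

/-- The action on the states of the transition semigroup with a unit adjoined. -/
def actionWithOne (s : WithOne M.transitionSemigroup) (p : σ) : Option σ :=
  match s with
  | none => some p
  | some t => t.1 p

theorem actionWithOne_coe_mul (s : M.transitionSemigroup) (t : WithOne M.transitionSemigroup)
    (p : σ) : actionWithOne ((s : WithOne M.transitionSemigroup) * t) p =
      (s.1 p).bind fun q => actionWithOne t q := by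
  cases t with
  | one =>
    change s.1 p = (s.1 p).bind some
    simp
  | coe t => rfl

theorem actionWithOne_wordValue (w : List α) (p : σ) :
    actionWithOne (wordValue M.letterAction w) p = M.run p w := by
  induction w generalizing p with
  | nil => rfl
  | cons a w ih =>
    have : wordValue M.letterAction (a :: w) =
        (M.letterAction a : WithOne M.transitionSemigroup) * wordValue M.letterAction w := by
      simp [wordValue]
    rw [this, actionWithOne_coe_mul, run_cons]
    simp only [ih]
    rfl

theorem wordValue_letterAction_eq {u v : List α} (hu : u ≠ []) (hv : v ≠ [])
    (h : ∀ p, M.run p u = M.run p v) :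
    wordValue M.letterAction u = wordValue M.letterAction v := by
  obtain ⟨s, hs⟩ := exists_coe_eq_wordValue M.letterAction hu
  obtain ⟨t, ht⟩ := exists_coe_eq_wordValue M.letterAction hv
  rw [← hs, ← ht]
  congr 1
  apply Subtype.ext
  funext p
  have h1 := actionWithOne_wordValue (M := M) u p
  have h2 := actionWithOne_wordValue (M := M) v p
  rw [← hs] at h1
  rw [← ht] at h2
  exact h1.trans ((h p).trans h2.symm)

theorem exists_wordValue_letterAction (s : M.transitionSemigroup) :
    ∃ w : List α, w ≠ [] ∧ (s : WithOne M.transitionSemigroup) = wordValue M.letterAction w := by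
  obtain ⟨s, hs⟩ := s
  induction hs using Subsemigroup.closure_induction with
  | mem x hx =>
    obtain ⟨a, rfl⟩ := hx
    exact ⟨[a], by simp, by simp [wordValue]; rfl⟩
  | mul x y hx hy ihx ihy =>
    obtain ⟨u, hu, hu'⟩ := ihx
    obtain ⟨v, hv, hv'⟩ := ihy
    exact ⟨u ++ v, by simp [hu], by rw [wordValue_append, ← hu', ← hv']; rfl⟩

theorem RunTestable.satisfiesBeta {k : ℕ} (h : M.RunTestable k) :
    SatisfiesBeta k M.transitionSemigroup :=
  satisfiesBeta_of_wordValue h.1 M.letterAction exists_wordValue_letterAction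
    fun u v hu hv huv => wordValue_letterAction_eq hu hv (h.2 u v hu hv huv)

theorem run_of_satisfiesBeta {n : ℕ} (h : SatisfiesBeta n M.transitionSemigroup) {X y z : List α}
    (hX : X.length = n - 1) (hy : y ≠ []) (hz : z ≠ []) (p : σ) :
    M.run p (X ++ y ++ X ++ z ++ X) = M.run p (X ++ z ++ X ++ y ++ X) := by
  rw [← actionWithOne_wordValue, ← actionWithOne_wordValue, h.wordValue M.letterAction hX hy hz]

/-! ### Pairs of states fixed by a word -/

theorem RunTestable.exists_long_fixing {m : ℕ} {e : List α} (he : e ≠ []) :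
    ∃ E : List α, m ≤ E.length + 1 ∧ ∀ p, M.run p e = some p → M.run p E = some p := by
  refine ⟨(replicate m e).flatten, ?_, fun p hp => ?_⟩
  · have := length_pos_of_ne_nil he
    simp only [length_flatten, map_replicate, sum_replicate, smul_eq_mul]
    nlinarith
  · induction m with
    | zero => rfl
    | succ m ih => rw [replicate_succ, flatten_cons, run_append_of_eq hp, ih]

theorem RunTestable.run_swap {m : ℕ} (hM : M.RunTestable m) {X y z : List α} (hX : m ≤ X.length + 1)
    (hy : y ≠ []) (p : σ) :
    M.run p (X ++ y ++ X ++ z ++ X) = M.run p (X ++ z ++ X ++ y ++ X) :=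
  hM.2 _ _ (by simp [hy]) (by simp [hy]) (SameTestData.swap hM.1 hX _ _) p

theorem RunTestable.run_duplicate {m : ℕ} (hM : M.RunTestable m) {X y : List α}
    (hX : m ≤ X.length + 1) (hy : y ≠ []) (p : σ) :
    M.run p (X ++ y ++ X) = M.run p (X ++ y ++ X ++ y ++ X) :=
  hM.2 _ _ (by simp [hy]) (by simp [hy]) (SameTestData.duplicate hM.1 hX _) p

theorem ne_nil_of_run {p q : σ} {w : List α} (h : M.run p w = some q) (hpq : p ≠ q) : w ≠ [] := by
  rintro rfl
  exact hpq (Option.some.inj h)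

/-- Distinct states of one strongly connected component have no common nonempty stabilizing word. -/
theorem RunTestable.eq_of_fixed {m : ℕ} (hM : M.RunTestable m) {p q : σ} {e : List α} (he : e ≠ [])
    (hp : M.run p e = some p) (hq : M.run q e = some q) (h : M.SameSCC p q) : p = q := by
  by_contra hne
  obtain ⟨E, hE, hfix⟩ := RunTestable.exists_long_fixing (M := M) (m := m) he
  have hpE := hfix p hp
  have hqE := hfix q hq
  obtain ⟨⟨t, ht⟩, s, hs⟩ := h
  have ht0 := ne_nil_of_run ht hne
  have hs0 := ne_nil_of_run hs (Ne.symm hne)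
  -- Duplication shows that `tE` fixes `q` and `sE` fixes `p`. Then `EtEsE` sends `p` to `p` while
  -- the swapped word `EsEtE` sends it to `q`.
  have h1 := hM.run_duplicate (y := t) hE ht0 p
  have h2 := hM.run_duplicate (y := s) hE hs0 q
  have h3 := hM.run_swap (z := s) hE ht0 p
  simp only [run_append, hpE, hqE, ht, hs, Option.bind_some] at h1 h2 h3
  -- `t` fixes `q` and `s` fixes `p` up to `E`
  cases hqt : M.run q t with
  | none => rw [hqt] at h1; simp at h1
  | some q' =>
    rw [hqt, Option.bind_some] at h1
    cases hps : M.run p s with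
    | none => rw [hps] at h2; simp at h2
    | some p' =>
      rw [hps, Option.bind_some] at h2
      rw [hps, Option.bind_some, ← h2, Option.bind_some, ht, Option.bind_some, hqE] at h3
      exact hne (Option.some.inj h3)

/-- Let `E` be a long power of `e`. If `sz` leads from `p` to `q`, duplicating it between copies of
`E` shows that `szE` fixes `q`. If `sz` fixes `q` and `t` leads from `p` to `q`, swapping `t` with
`sz` lets `p` read `s` first and still end in `q`. -/
theorem RunTestable.reaches_iff_of_fixed {m : ℕ} (hM : M.RunTestable m) {p q : σ} {e : List α}
    (he : e ≠ []) (hp : M.run p e = some p) (hq : M.run q e = some q) (h : M.Reaches p q)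
    (s : List α) : (∃ z, M.run p (s ++ z) = some q) ↔ ∃ z, M.run q (s ++ z) = some q := by
  by_cases hne : p = q
  · rw [hne]
  obtain ⟨E, hE, hfix⟩ := RunTestable.exists_long_fixing (M := M) (m := m) he
  have hpE := hfix p hp
  have hqE := hfix q hq
  obtain ⟨t, ht⟩ := h
  constructor
  · rintro ⟨z, hz⟩
    have h1 := hM.run_duplicate (y := s ++ z) hE (ne_nil_of_run hz hne) p
    rw [append_assoc (E ++ (s ++ z) ++ E), run_append p (E ++ (s ++ z) ++ E)] at h1
    have h2 : M.run p (E ++ (s ++ z) ++ E) = some q := by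
      rw [append_assoc, run_append_of_eq hpE, run_append_of_eq hz, hqE]
    rw [h2, Option.bind_some] at h1
    exact ⟨z ++ E, by rw [← append_assoc, ← h1]⟩
  · rintro ⟨z, hz⟩
    have h1 := hM.run_swap (z := s ++ z) hE (ne_nil_of_run ht hne) p
    have h2 : M.run p (E ++ t ++ E ++ (s ++ z) ++ E) = some q := by
      simp only [append_assoc]
      rw [run_append_of_eq hpE, run_append_of_eq ht, run_append_of_eq hqE, ← append_assoc,
        run_append_of_eq hz, hqE]
    rw [h2] at h1
    refine ⟨z ++ (E ++ t ++ E), ?_⟩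
    simp only [append_assoc] at h1 ⊢
    rw [run_append_of_eq hpE] at h1
    exact h1.symm

/-! ### Failure of the identity of testability -/

theorem TuplePath.exists_word {n : ℕ} (P : M.TuplePath n) :
    ∃ X : List α, X.length = n ∧ M.run (P.node 0).1.1 X = some (P.node (Fin.last n)).1.1 ∧
      M.run (P.node 0).1.2 X = some (P.node (Fin.last n)).1.2 := by
  suffices h : ∀ i : Fin (n + 1), ∃ X : List α, X.length = i ∧
      M.run (P.node 0).1.1 X = some (P.node i).1.1 ∧
      M.run (P.node 0).1.2 X = some (P.node i).1.2 by simpa using h (Fin.last n)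
  intro i
  induction i using Fin.induction with
  | zero => exact ⟨[], rfl, rfl, rfl⟩
  | succ i ih =>
    obtain ⟨X, hX, h1, h2⟩ := ih
    obtain ⟨a, ha, hb⟩ := P.edge i
    exact ⟨X ++ [a], by simp [hX], by rw [run_append_of_eq h1, run_singleton, ha],
      by rw [run_append_of_eq h2, run_singleton, hb]⟩

theorem TuplePath.IsSCCRestricted.not_satisfiesBeta {m n : ℕ} (hM : M.RunTestable m)
    {P : M.TuplePath n} (hP : P.IsSCCRestricted) :
    ¬ SatisfiesBeta (n + 1) M.transitionSemigroup := by
  intro hβ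
  obtain ⟨X, hX, hp, hq⟩ := P.exists_word
  obtain ⟨c, hc⟩ := hP
  obtain ⟨⟨-, hp₀⟩, -, hq₀⟩ := hc 0
  obtain ⟨⟨hcp, hpc⟩, hcq, hqc⟩ := hc (Fin.last n)
  have hne₀ := (P.node 0).2.2
  have hne := (P.node (Fin.last n)).2.2
  obtain ⟨⟨hcp₀, -⟩, hcq₀, -⟩ := hc 0
  generalize (P.node 0).1.1 = p₀ at *
  generalize (P.node 0).1.2 = q₀ at *
  generalize (P.node (Fin.last n)).1.1 = p at *
  generalize (P.node (Fin.last n)).1.2 = q at *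
  -- nonempty words exist between any two states of the component
  have hword : ∀ a b, M.Reaches a p₀ → M.Reaches p₀ b → ∃ w, w ≠ [] ∧ M.run a w = some b := by
    rintro a b ⟨u, hu⟩ ⟨v, hv⟩
    obtain ⟨s, hs⟩ := hp₀.trans hcq₀
    obtain ⟨t, ht⟩ := hq₀.trans hcp₀
    refine ⟨u ++ (s ++ (t ++ v)), by simp [ne_nil_of_run hs hne₀], ?_⟩
    rw [run_append_of_eq hu, run_append_of_eq hs, run_append_of_eq ht, hv]
  obtain ⟨y, hy, hy'⟩ := hword p q₀ (hpc.trans hcp₀) (hp₀.trans hcq₀)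
  obtain ⟨z, hz, hz'⟩ := hword p p₀ (hpc.trans hcp₀) (Reaches.refl _)
  -- From `p₀` the word `XzXyX` leads to `q`, while `XyX` already leads there; so the identity makes
  -- `zX` fix `q`, and it fixes `p` by the choice of `z`.
  have h := run_of_satisfiesBeta hβ (by simpa using hX) hy hz p₀
  simp only [run_append, hp, hq, hy', hz', Option.bind_some] at h
  have hpz : M.run p (z ++ X) = some p := by rw [run_append_of_eq hz', hp]
  have hqz : M.run q (z ++ X) = some q := by rw [run_append, h]
  exact hne (hM.eq_of_fixed (by simp [hz]) hpz hqz ⟨hpc.trans hcq, hqc.trans hcp⟩)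

theorem TuplePath.IsSCCSemirestricted.not_satisfiesBeta {n : ℕ}
    {P : M.TuplePath n} (hP : P.IsSCCSemirestricted) :
    ¬ SatisfiesBeta (n + 1) M.transitionSemigroup := by
  intro hβ
  obtain ⟨X, hX, hp, hq⟩ := P.exists_word
  obtain ⟨a, r, hr, ⟨z, hz⟩, hnot⟩ := hP
  obtain ⟨⟨t, ht⟩, hne⟩ := (P.node (Fin.last n)).2
  generalize (P.node 0).1.1 = p₀ at *
  generalize (P.node 0).1.2 = q₀ at *
  generalize (P.node (Fin.last n)).1.1 = p at *
  generalize (P.node (Fin.last n)).1.2 = q at *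
  have haz : M.run q (a :: z) = some q₀ := by rw [run_cons, hr, Option.bind_some, hz]
  -- The left side crosses from `p` to `q` by `t` before reading `a`. The right side reads `a` at
  -- `p` itself, so `p a` would be defined and reach `q`, hence `r`.
  have h := run_of_satisfiesBeta hβ (y := t ++ a :: z) (z := a :: z) (by simpa using hX)
    (by simp) (by simp) p₀
  have h1 : M.run p₀ (X ++ (t ++ a :: z) ++ X ++ (a :: z) ++ X) = some q := by
    simp only [append_assoc]
    rw [run_append_of_eq hp, run_append_of_eq ht, run_append_of_eq haz, run_append_of_eq hq,
      run_append_of_eq haz, hq]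
  rw [h1] at h
  have h2 := h.symm
  simp only [append_assoc] at h2
  rw [run_append_of_eq hp, cons_append, run_cons] at h2
  obtain ⟨p', hp', hw⟩ := Option.bind_eq_some_iff.1 h2
  exact hnot ⟨p', hp', Reaches.trans ⟨_, hw⟩ (Reaches.of_step hr)⟩

end PartialDFA

namespace PartialDFA

open List

variable {α : Type u} {σ : Type v} {M : PartialDFA α σ}

/-! ### Simple paths of bounded length -/

variable (M) in
/-- The simple paths of the 2-tuple graph have fewer than `n` edges. -/
def SimplePathsShorter (n : ℕ) : Prop := ∀ (m : ℕ) (P : M.TuplePath m), P.IsSimple → m < n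

variable (M) in
/-- A letter leads from the pair `x` to the pair `y`. -/
def PairStep (x y : σ × σ) : Prop := ∃ a, M.step x.1 a = some y.1 ∧ M.step x.2 a = some y.2

theorem SimplePathsShorter.length_le {n : ℕ} (h : M.SimplePathsShorter n) {L : List (σ × σ)}
    (hL : ∀ x ∈ L, M.StrictlyReaches x.1 x.2) (hc : L.IsChain M.PairStep) (hd : L.Nodup) :
    L.length ≤ n := by
  cases L with
  | nil => simp
  | cons x L =>
    refine h L.length ⟨fun i => ⟨(x :: L)[i.1], hL _ (getElem_mem _)⟩, fun i => ?_⟩ ?_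
    · exact isChain_iff_getElem.1 hc i.1 (by simp)
    · intro i j hij
      exact Fin.ext ((hd.getElem_inj_iff).1 (congrArg Subtype.val hij))

/-- Pigeonhole: `n` steps visit `n + 1` nodes, one more than a simple path can have. -/
theorem SimplePathsShorter.exists_repeat {n : ℕ} (h : M.SimplePathsShorter n) {A B : ℕ → σ}
    (hs : ∀ i < n, M.PairStep (A i, B i) (A (i + 1), B (i + 1)))
    (hr : ∀ i ≤ n, M.StrictlyReaches (A i) (B i)) :
    ∃ i j, i < j ∧ j ≤ n ∧ A i = A j ∧ B i = B j := by
  by_contra hcon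
  push Not at hcon
  have hinj : ∀ i j, i < j → j ≤ n → (A i, B i) ≠ (A j, B j) := fun i j hij hj he =>
    hcon i j hij hj (congrArg Prod.fst he) (congrArg Prod.snd he)
  have hle := h.length_le (L := (List.range (n + 1)).map fun i => (A i, B i)) ?_ ?_ ?_
  · simp at hle
  · simp only [mem_map, mem_range]
    rintro x ⟨i, hi, rfl⟩
    exact hr i (by omega)
  · rw [isChain_iff_getElem]
    intro i hi
    simp only [length_map, length_range] at hi
    simpa using hs i (by omega)
  · refine Nodup.map_on ?_ nodup_range
    simp only [mem_range]
    intro i hi j hj he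
    rcases lt_trichotomy i j with hij | hij | hij
    · exact absurd he (hinj i j hij (by omega))
    · exact hij
    · exact absurd he.symm (hinj j i hij (by omega))

/-- If two states, the second one reachable from the first at each moment, are not merged by a word
of length `n`, then reading it both pass through a common loop. -/
theorem SimplePathsShorter.exists_common_loop {n : ℕ} (h : M.SimplePathsShorter n) {X : List α}
    (hX : X.length = n) {a b s q : σ} (ha : M.run a X = some s) (hb : M.run b X = some q)
    (hsq : s ≠ q) (hsb : M.Reaches s b) :
    ∃ a' b' e c, e ≠ [] ∧ M.run a' e = some a' ∧ M.run b' e = some b' ∧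
      M.run a' c = some s ∧ M.run b' c = some q ∧ M.Reaches a a' ∧ M.Reaches b b' := by
  have hsome : ∀ {a s : σ}, M.run a X = some s → ∀ i,
      M.run a (X.take i) = some ((M.run a (X.take i)).getD a) := by
    intro a s hs i
    rw [← take_append_drop i X] at hs
    obtain ⟨q, hq, -⟩ := run_append_eq_some.1 hs
    rw [hq, Option.getD_some]
  -- All prefixes of `X` can be read from `a` and `b`, so the default values of `getD` never occur.
  have hA := hsome ha
  have hB := hsome hb
  set A : ℕ → σ := fun i => (M.run a (X.take i)).getD a
  set B : ℕ → σ := fun i => (M.run b (X.take i)).getD b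
  change ∀ i, M.run a (X.take i) = some (A i) at hA
  change ∀ i, M.run b (X.take i) = some (B i) at hB
  have hword : ∀ i j, i ≤ j → ∃ w, X.take j = X.take i ++ w ∧
      w.length = min j X.length - min i X.length := by
    intro i j hij
    refine ⟨(X.take j).drop i, ?_, by simp; omega⟩
    conv_lhs => rw [← take_append_drop i (X.take j)]
    rw [take_take, min_eq_left hij]
  have hend : ∀ i, M.run (A i) (X.drop i) = some s ∧ M.run (B i) (X.drop i) = some q := by
    intro i
    rw [← take_append_drop i X, run_append_of_eq (hA i)] at ha
    rw [← take_append_drop i X, run_append_of_eq (hB i)] at hb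
    exact ⟨ha, hb⟩
  have hs : ∀ i < n, M.PairStep (A i, B i) (A (i + 1), B (i + 1)) := by
    intro i hi
    obtain ⟨w, hw, hwl⟩ := hword i (i + 1) (Nat.le_succ i)
    obtain ⟨c, rfl⟩ : ∃ c, w = [c] := length_eq_one_iff.1 (by omega)
    have h1 := hA (i + 1)
    have h2 := hB (i + 1)
    rw [hw, run_append_of_eq (hA i), run_singleton] at h1
    rw [hw, run_append_of_eq (hB i), run_singleton] at h2
    exact ⟨c, h1, h2⟩
  have hr : ∀ i ≤ n, M.StrictlyReaches (A i) (B i) := by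
    intro i _
    refine ⟨Reaches.trans ⟨_, (hend i).1⟩ (hsb.trans ⟨_, hB i⟩), fun he => hsq ?_⟩
    have := (hend i).1
    rw [he, (hend i).2] at this
    exact (Option.some.inj this).symm
  obtain ⟨i, j, hij, hj, hAij, hBij⟩ := h.exists_repeat hs hr
  obtain ⟨w, hw, hwl⟩ := hword i j hij.le
  have h1 := hA j
  have h2 := hB j
  rw [hw, run_append_of_eq (hA i), ← hAij] at h1
  rw [hw, run_append_of_eq (hB i), ← hBij] at h2
  exact ⟨A i, B i, w, X.drop i, ne_nil_of_length_pos (by omega), h1, h2, (hend i).1, (hend i).2,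
    ⟨_, hA i⟩, ⟨_, hB i⟩⟩

variable (M) in
/-- The state `q` is reached by `X` from a state of its strongly connected component. -/
def Recurrent (X : List α) (q : σ) : Prop := ∃ b, M.run b X = some q ∧ M.Reaches q b

/-- The two runs of `X` pass through a common loop at a pair `(a', b')` and leave it by `c`. The
claim is `RunTestable.reaches_iff_of_fixed` for this pair and the word `c ++ w`. -/
theorem Recurrent.reaches_iff {m n : ℕ} (hM : M.RunTestable m) (h : M.SimplePathsShorter n)
    {X : List α} (hX : X.length = n) {a s q : σ} (ha : M.run a X = some s) (hq : M.Recurrent X q)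
    (hsq : M.Reaches s q) (w : List α) :
    (∃ z, M.run s (w ++ z) = some q) ↔ ∃ z, M.run q (w ++ z) = some q := by
  by_cases hne : s = q
  · rw [hne]
  obtain ⟨b, hb, hqb⟩ := hq
  obtain ⟨a', b', e, c, he, hae, hbe, hac, hbc, -, hbb⟩ :=
    h.exists_common_loop hX ha hb hne (hsq.trans hqb)
  obtain ⟨d, hd⟩ := hqb.trans hbb
  have hab : M.Reaches a' b' := Reaches.trans ⟨_, hac⟩ (hsq.trans ⟨_, hd⟩)
  have key := hM.reaches_iff_of_fixed he hae hbe hab (c ++ w)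
  constructor
  · rintro ⟨z, hz⟩
    obtain ⟨z', hz'⟩ := key.1 ⟨z ++ d, by
      rw [append_assoc, run_append_of_eq hac, ← append_assoc, run_append_of_eq hz, hd]⟩
    refine ⟨z' ++ c, ?_⟩
    rw [append_assoc, run_append_of_eq hbc] at hz'
    rw [← append_assoc, run_append_of_eq hz', hbc]
  · rintro ⟨z, hz⟩
    obtain ⟨z', hz'⟩ := key.2 ⟨z ++ d, by
      rw [append_assoc, run_append_of_eq hbc, ← append_assoc, run_append_of_eq hz, hd]⟩
    refine ⟨z' ++ c, ?_⟩
    rw [append_assoc, run_append_of_eq hac] at hz'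
    rw [← append_assoc, run_append_of_eq hz', hbc]

theorem Recurrent.eq_of_sameSCC {m n : ℕ} (hM : M.RunTestable m) (h : M.SimplePathsShorter n)
    {X : List α} (hX : X.length = n) {s q : σ} (hs : M.Recurrent X s) (hq : M.Recurrent X q)
    (hsq : M.SameSCC s q) : s = q := by
  by_contra hne
  obtain ⟨a, ha, hsa⟩ := hs
  obtain ⟨b, hb, hqb⟩ := hq
  obtain ⟨a', b', e, c, he, hae, hbe, hac, hbc, haa, hbb⟩ :=
    h.exists_common_loop hX ha hb hne (hsq.1.trans hqb)
  have hab : a' = b' := hM.eq_of_fixed he hae hbe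
    ⟨Reaches.trans ⟨_, hac⟩ (hsq.1.trans (hqb.trans hbb)),
      Reaches.trans ⟨_, hbc⟩ (hsq.2.trans (hsa.trans haa))⟩
  rw [hab, hbc] at hac
  exact hne (Option.some.inj hac).symm

theorem suffix_append_flatten_replicate {X g : List α} (hg : X <:+ X ++ g) (m : ℕ) :
    X <:+ X ++ (replicate m g).flatten := by
  induction m with
  | zero => simp
  | succ m ih =>
    rw [replicate_succ, flatten_cons, ← append_assoc, suffix_append_iff_of_suffix hg le_rfl]
    exact ih

/-- Powers of a loop at `X` that are long enough end in `X`, and they fix `q`; `X.length` copies of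
the nonempty `g` suffice. -/
theorem recurrent_of_loop {X g : List α} (hg : X <:+ X ++ g) (hg0 : g ≠ []) {q : σ}
    (hq : M.run q g = some q) : M.Recurrent X q := by
  have hrun : ∀ m, M.run q (replicate m g).flatten = some q := by
    intro m
    induction m with
    | zero => rfl
    | succ m ih => rw [replicate_succ, flatten_cons, run_append_of_eq hq, ih]
  have hlen : X.length ≤ (replicate X.length g).flatten.length := by
    have := length_pos_of_ne_nil hg0
    simp only [length_flatten, map_replicate, sum_replicate, smul_eq_mul]
    nlinarith
  obtain ⟨y, hy⟩ := suffix_of_suffix_length_le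
    (suffix_append_flatten_replicate hg X.length) (suffix_append X _) hlen
  have := hrun X.length
  rw [← hy] at this
  obtain ⟨b, hb, hbX⟩ := run_append_eq_some.1 this
  exact ⟨b, hbX, _, hb⟩

/-! ### Reading a periodic word -/

/-- The word `W i, …, W (i + l - 1)`. -/
def segment (W : ℕ → α) (i l : ℕ) : List α := (List.range l).map fun j => W (i + j)

theorem segment_succ (W : ℕ → α) (i l : ℕ) : segment W i (l + 1) = segment W i l ++ [W (i + l)] := by
  simp [segment, range_succ]

theorem segment_add_period {W : ℕ → α} {τ : ℕ} (hW : ∀ i, W (i + τ) = W i) (i l : ℕ) :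
    segment W (i + τ) l = segment W i l := by
  simp only [segment]
  congr 1
  funext j
  rw [add_right_comm, hW]

theorem segment_ne_nil (W : ℕ → α) (i : ℕ) {l : ℕ} (hl : 0 < l) : segment W i l ≠ [] := by
  simp [segment]; omega

section Periodic

variable {W : ℕ → α} {τ : ℕ} {P : ℕ → Option σ}

theorem run_segment (hP : ∀ i, P (i + 1) = (P i).bind fun p => M.step p (W i)) {i : ℕ} {p : σ}
    (hp : P i = some p) (l : ℕ) : M.run p (segment W i l) = P (i + l) := by
  induction l with
  | zero => simp [segment, hp]
  | succ l ih =>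
    rw [segment_succ, run_append, ih, ← add_assoc, hP]
    simp only [run_singleton]

theorem exists_eq_some_of_le (hP : ∀ i, P (i + 1) = (P i).bind fun p => M.step p (W i))
    {i j : ℕ} (hij : i ≤ j) {q : σ} (hq : P j = some q) :
    ∃ p, P i = some p ∧ M.Reaches p q := by
  obtain ⟨l, rfl⟩ := Nat.exists_eq_add_of_le hij
  cases hp : P i with
  | some p => exact ⟨p, rfl, _, by rw [run_segment hP hp l, hq]⟩
  | none =>
    have : ∀ l, P (i + l) = none := by
      intro l
      induction l with
      | zero => exact hp
      | succ l ih => rw [← add_assoc, hP, ih, Option.bind_none]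
    rw [this] at hq
    simp at hq

theorem eq_add_period (hP : ∀ i, P (i + 1) = (P i).bind fun p => M.step p (W i))
    (hW : ∀ i, W (i + τ) = W i) {i : ℕ} (h : P i = P (i + τ)) {j : ℕ} (hij : i ≤ j) :
    P j = P (j + τ) := by
  induction hij with
  | refl => exact h
  | @step j _ ih => rw [Nat.succ_eq_add_one, hP, ih, add_right_comm, hP, hW]

/-- A repeated pair of states at distance one period makes the run go on forever, staying above the
second state of the pair. -/
theorem RunTestable.reaches_of_repeat {m : ℕ} (hM : M.RunTestable m) (hτ : 0 < τ)
    (hW : ∀ i, W (i + τ) = W i) (hP : ∀ i, P (i + 1) = (P i).bind fun p => M.step p (W i))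
    {i j : ℕ} (hij : i < j) {p c : σ} (hi : P i = some p) (hj : P j = some p)
    (hi' : P (i + τ) = some c) (hj' : P (j + τ) = some c) {l : ℕ} (hl : j ≤ l) :
    ∃ x, P l = some x ∧ M.Reaches x c := by
  have hpe : M.run p (segment W i (j - i)) = some p := by
    rw [run_segment hP hi, Nat.add_sub_cancel' hij.le, hj]
  have hce : M.run c (segment W i (j - i)) = some c := by
    rw [← segment_add_period hW, run_segment hP hi', ← hj']
    congr 1
    omega
  have hpc : M.Reaches p c := by
    obtain ⟨p', hp', h⟩ := exists_eq_some_of_le hP (Nat.le_add_right i τ) hi'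
    rw [hi] at hp'
    exact Option.some.inj hp' ▸ h
  -- The word read from `p` during `[j, l)` is also read from `c` one period later. Since it can be
  -- continued from `p` to `c`, it can be continued from `c` to `c`, which gives the claim at time
  -- `l + τ`.
  induction l using Nat.strong_induction_on with
  | _ l ih =>
    by_cases hlj : l ≤ j + τ
    · exact exists_eq_some_of_le hP hlj hj'
    obtain ⟨l, rfl⟩ : ∃ l', l = l' + τ := ⟨l - τ, by omega⟩
    obtain ⟨x, hx, z, hz⟩ := ih l (by omega) (by omega)
    have h1 : M.run p (segment W j (l - j)) = some x := by
      rw [run_segment hP hj, Nat.add_sub_cancel' (by omega), hx]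
    obtain ⟨z', hz'⟩ := (hM.reaches_iff_of_fixed (segment_ne_nil W i (by omega)) hpe hce hpc
      (segment W j (l - j))).1 ⟨z, by rw [run_append_of_eq h1, hz]⟩
    obtain ⟨x', hx', hz''⟩ := run_append_eq_some.1 hz'
    refine ⟨x', ?_, z', hz''⟩
    rw [← segment_add_period hW, run_segment hP hj'] at hx'
    rw [← hx']
    congr 1
    omega

end Periodic

/-- Along an infinite run over a periodic word the states one and two periods after time `n` agree. -/
theorem SimplePathsShorter.eq_add_period_of_run {m n : ℕ} (hM : M.RunTestable m)
    (h : M.SimplePathsShorter n) {W : ℕ → α} {τ : ℕ} (hτ : 0 < τ) (hW : ∀ i, W (i + τ) = W i)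
    {A : ℕ → σ} (hA : ∀ i, M.step (A i) (W i) = some (A (i + 1))) :
    A (n + τ) = A (n + τ + τ) := by
  by_contra hne
  have hP : ∀ i, (fun i => some (A i)) (i + 1) =
      ((fun i => some (A i)) i).bind fun p => M.step p (W i) := fun i => (hA i).symm
  have hreach : ∀ {i j}, i ≤ j → M.Reaches (A i) (A j) := by
    intro i j hij
    obtain ⟨p, hp, hr⟩ := exists_eq_some_of_le (P := fun i => some (A i)) hP hij rfl
    exact Option.some.inj hp ▸ hr
  have hne' : ∀ i ≤ n + τ, A i ≠ A (i + τ) := fun i hi he =>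
    hne (Option.some.inj (eq_add_period (P := fun i => some (A i)) hP hW (congrArg some he) hi))
  set N : ℕ → σ × σ := fun i => (A i, A (i + τ)) with hN
  have hstrict : ∀ i ≤ n + τ, M.StrictlyReaches (N i).1 (N i).2 := fun i hi =>
    ⟨hreach (Nat.le_add_right i τ), hne' i hi⟩
  have hstep : ∀ i, M.PairStep (N i) (N (i + 1)) := fun i =>
    ⟨W i, hA i, by have := hA (i + τ); rwa [hW, add_right_comm] at this⟩
  have hrep : ∀ {i j}, i < j → N i = N j → ∀ l, j ≤ l → M.Reaches (A l) (A (i + τ)) := by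
    intro i j hij he l hl
    have h1 : A i = A j := congrArg Prod.fst he
    have h2 : A (i + τ) = A (j + τ) := congrArg Prod.snd he
    obtain ⟨x, hx, hr⟩ := hM.reaches_of_repeat (P := fun i => some (A i)) hτ hW hP hij rfl
      (congrArg some h1.symm) rfl
      (congrArg some h2.symm) hl
    exact Option.some.inj hx ▸ hr
  obtain ⟨i₁, i₂, hi, hi₂, h1, h2⟩ := h.exists_repeat (A := A) (B := fun i => A (i + τ))
    (fun i _ => hstep i) (fun i hi => hstrict i (by omega))
  -- Every state of the run reaches `A (i₁ + τ)`, so the run ends in the component of that state.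
  have hback : ∀ l, M.Reaches (A l) (A (i₁ + τ)) := fun l =>
    (hreach (Nat.le_add_right l i₂)).trans (hrep hi (Prod.ext h1 h2) _ (Nat.le_add_left _ _))
  -- the run enters the final strongly connected component one period after time `j`
  classical
  have hex : ∃ j, M.SameSCC (A (i₁ + τ)) (A (j + τ)) := ⟨i₁, Reaches.refl _, Reaches.refl _⟩
  set j := Nat.find hex with hj
  have hjspec : M.SameSCC (A (i₁ + τ)) (A (j + τ)) := Nat.find_spec hex
  have hjmin : ∀ i < j, ¬ M.SameSCC (A (i₁ + τ)) (A (i + τ)) := fun i hi => Nat.find_min hex hi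
  have hji : j ≤ i₁ := Nat.find_min' hex ⟨Reaches.refl _, Reaches.refl _⟩
  have hC : ∀ l, j + τ ≤ l → M.Reaches (A (i₁ + τ)) (A l) := fun l hl => hjspec.1.trans (hreach hl)
  -- Both coordinates are now in the final component; a repetition would make one word fix two
  -- distinct states of it.
  have hlast : ∀ x y, j + τ ≤ x → x < y → y ≤ n + τ → N x ≠ N y := by
    intro x y hx hxy hy he
    have e1 : A x = A y := congrArg Prod.fst he
    have e2 : A (x + τ) = A (y + τ) := congrArg Prod.snd he
    have hyx : x + (y - x) = y := by omega
    refine hne' x (by omega) (hM.eq_of_fixed (segment_ne_nil W x (l := y - x) (by omega)) ?_ ?_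
      ⟨hreach (by omega), (hback _).trans (hC x hx)⟩)
    · rw [run_segment (P := fun i => some (A i)) hP rfl, hyx, e1]
    · rw [← segment_add_period hW, run_segment (P := fun i => some (A i)) hP rfl, e2, add_right_comm, hyx]
  -- A repetition of `N x` would put `A (x + τ)` into the final component, against the minimality of
  -- `j`.
  have hfirst : ∀ x y, x < j → x < y → N x ≠ N y := fun x y hx hxy he =>
    hjmin x hx ⟨(hC (j + τ + y) (by omega)).trans (hrep hxy he _ (by omega)), hreach (by omega)⟩
  set L₃ := (List.range (n + 1 - j)).map fun i => N (j + τ + i) with hL₃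
  have hL₃len : L₃.length = n + 1 - j := by simp [hL₃]
  have hL₃mem : ∀ x ∈ L₃, ∃ l, j + τ ≤ l ∧ l ≤ n + τ ∧ x = N l := by
    simp only [hL₃, mem_map, mem_range]
    rintro x ⟨i, hi, rfl⟩
    exact ⟨_, by omega, by omega, rfl⟩
  have hL₃chain : L₃.IsChain M.PairStep := by
    rw [isChain_iff_getElem]
    intro i _
    simpa [hL₃, ← add_assoc] using hstep (j + τ + i)
  have hL₃nodup : L₃.Nodup := by
    refine Nodup.map_on ?_ nodup_range
    simp only [mem_range]
    intro x hx y hy he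
    rcases lt_trichotomy x y with hxy | hxy | hxy
    · exact absurd he (hlast _ _ (by omega) (by omega) (by omega))
    · exact hxy
    · exact absurd he.symm (hlast _ _ (by omega) (by omega) (by omega))
  have hlen : ∀ L : List (σ × σ), (∀ x ∈ L, ∃ l, l ≤ n + τ ∧ x = N l) → L.IsChain M.PairStep →
      L.Nodup → L.length ≤ n := by
    intro L hL hc hd
    refine h.length_le (fun x hx => ?_) hc hd
    obtain ⟨l, hl, rfl⟩ := hL x hx
    exact hstrict l hl
  rcases Nat.eq_zero_or_pos j with hj0 | hj0
  · have := hlen L₃ (fun x hx => by obtain ⟨l, -, h⟩ := hL₃mem x hx; exact ⟨l, h⟩) hL₃chain hL₃nodup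
    omega
  -- Nodes between times `j` and `j + τ` may repeat, so loops are erased going backwards: if `N i`
  -- already occurs, the path restarts at that occurrence. The final part `L₃` survives because the
  -- first coordinates here lie outside the final component.
  have hmid : ∀ d ≤ τ, ∃ T, (N (j + τ - d) :: T).IsChain M.PairStep ∧
      (N (j + τ - d) :: T).Nodup ∧ L₃ <:+ N (j + τ - d) :: T ∧
      ∀ x ∈ N (j + τ - d) :: T, ∃ l, j + τ - d ≤ l ∧ l ≤ n + τ ∧ x = N l := by
    intro d
    induction d with
    | zero =>
      intro _
      obtain ⟨T, hT⟩ : ∃ T, L₃ = N (j + τ) :: T := by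
        refine ⟨((List.range (n - j)).map Nat.succ).map fun i => N (j + τ + i), ?_⟩
        rw [hL₃, show n + 1 - j = (n - j) + 1 by omega, range_succ_eq_map]
        simp
      refine ⟨T, ?_⟩
      rw [Nat.sub_zero, ← hT]
      exact ⟨hL₃chain, hL₃nodup, suffix_rfl, hL₃mem⟩
    | succ d ih =>
      intro hd
      obtain ⟨T, hT1, hT2, hT3, hT4⟩ := ih (by omega)
      have hi : j + τ - d = j + τ - (d + 1) + 1 := by omega
      rw [hi] at hT1 hT2 hT3 hT4
      have hilt : j + τ - (d + 1) ≤ j - 1 + τ := by omega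
      have hile : j + τ - (d + 1) ≤ n + τ := by omega
      generalize j + τ - (d + 1) = i at *
      have hnot : N i ∉ L₃ := by
        intro hmem
        obtain ⟨l, hl, -, he⟩ := hL₃mem _ hmem
        have e1 : A i = A l := congrArg Prod.fst he
        refine hjmin (j - 1) (by omega) ⟨?_, hback _⟩
        exact (e1 ▸ hC l hl).trans (hreach hilt)
      by_cases hmem : N i ∈ N (i + 1) :: T
      · obtain ⟨L₁, L₂, hL⟩ := append_of_mem hmem
        rw [hL] at hT1 hT2 hT3 hT4
        have hsuf : N i :: L₂ <:+ L₁ ++ N i :: L₂ := suffix_append _ _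
        refine ⟨L₂, hT1.suffix hsuf, hT2.sublist hsuf.sublist, ?_, fun x hx => ?_⟩
        · rcases suffix_or_suffix_of_suffix hT3 hsuf with hs | hs
          · exact hs
          · exact absurd (hs.mem mem_cons_self) hnot
        · obtain ⟨l, hl, hl', rfl⟩ := hT4 x (hsuf.mem hx)
          exact ⟨l, by omega, hl', rfl⟩
      · refine ⟨N (i + 1) :: T, isChain_cons_cons.2 ⟨hstep i, hT1⟩, nodup_cons.2 ⟨hmem, hT2⟩,
          hT3.trans (suffix_cons _ _), fun x hx => ?_⟩
        rcases mem_cons.1 hx with rfl | hx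
        · exact ⟨i, le_rfl, hile, rfl⟩
        · obtain ⟨l, hl, hl', rfl⟩ := hT4 x hx
          exact ⟨l, by omega, hl', rfl⟩
  -- The `j` nodes before time `j` never recur, so they all can be prepended to the `n + 1 - j`
  -- nodes of `L₃`: `n + 1` distinct nodes, one too many.
  have hpre : ∀ d ≤ j, ∃ T, (N (j - d) :: T).IsChain M.PairStep ∧ (N (j - d) :: T).Nodup ∧
      n + 1 - j + d ≤ (N (j - d) :: T).length ∧
      ∀ x ∈ N (j - d) :: T, ∃ l, j - d ≤ l ∧ l ≤ n + τ ∧ x = N l := by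
    intro d
    induction d with
    | zero =>
      intro _
      obtain ⟨T, hT1, hT2, hT3, hT4⟩ := hmid τ le_rfl
      rw [Nat.add_sub_cancel] at hT1 hT2 hT3 hT4
      exact ⟨T, hT1, hT2, hL₃len ▸ hT3.length_le, hT4⟩
    | succ d ih =>
      intro hd
      obtain ⟨T, hT1, hT2, hT3, hT4⟩ := ih (by omega)
      have hi : j - d = j - (d + 1) + 1 := by omega
      rw [hi] at hT1 hT2 hT3 hT4
      have hilt : j - (d + 1) < j := by omega
      generalize j - (d + 1) = i at *
      refine ⟨N (i + 1) :: T, isChain_cons_cons.2 ⟨hstep i, hT1⟩, nodup_cons.2 ⟨?_, hT2⟩, ?_,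
        fun x hx => ?_⟩
      · intro hmem
        obtain ⟨l, hl, -, he⟩ := hT4 _ hmem
        exact hfirst i l hilt (by omega) he
      · rw [length_cons]; omega
      · rcases mem_cons.1 hx with rfl | hx
        · exact ⟨i, le_rfl, by omega, rfl⟩
        · obtain ⟨l, hl, hl', rfl⟩ := hT4 x hx
          exact ⟨l, by omega, hl', rfl⟩
  obtain ⟨T, hT1, hT2, hT3, hT4⟩ := hpre j le_rfl
  have := hlen _ (fun x hx => by obtain ⟨l, -, h⟩ := hT4 x hx; exact ⟨l, h⟩) hT1 hT2
  omega

/-- If the run is defined up to time `n + τ` without agreeing with its shift by `τ`, some pair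
repeats among the first `n + 1`. By `RunTestable.reaches_of_repeat` the run is then infinite, and
`SimplePathsShorter.eq_add_period_of_run` applies. -/
theorem SimplePathsShorter.run_periodic {m n : ℕ} (hM : M.RunTestable m)
    (h : M.SimplePathsShorter n) {W : ℕ → α} {τ : ℕ} (hτ : 0 < τ) (hW : ∀ i, W (i + τ) = W i)
    {P : ℕ → Option σ} (hP : ∀ i, P (i + 1) = (P i).bind fun p => M.step p (W i)) :
    P (n + τ) = P (n + τ + τ) := by
  by_cases heq : ∃ i ≤ n + τ, P i = P (i + τ)
  · obtain ⟨i, hi, he⟩ := heq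
    exact eq_add_period hP hW he hi
  push Not at heq
  cases ht : P (n + τ) with
  | none =>
    cases ht' : P (n + τ + τ) with
    | none => rfl
    | some t =>
      obtain ⟨p, hp, -⟩ := exists_eq_some_of_le hP (Nat.le_add_right (n + τ) τ) ht'
      rw [ht] at hp
      simp at hp
  | some t =>
    have hsome : ∀ i ≤ n + τ, P i = some ((P i).getD t) := by
      intro i hi
      obtain ⟨p, hp, -⟩ := exists_eq_some_of_le hP hi ht
      rw [hp, Option.getD_some]
    have hstep : ∀ i < n + τ, M.step ((P i).getD t) (W i) = some ((P (i + 1)).getD t) := by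
      intro i hi
      rw [← hsome (i + 1) hi, hP, hsome i hi.le, Option.bind_some, Option.getD_some]
    have hr : ∀ i ≤ n, M.StrictlyReaches ((P i).getD t) ((P (i + τ)).getD t) := by
      refine fun i hi => ⟨?_, fun he => heq i (by omega) ?_⟩
      · obtain ⟨p, hp, hr⟩ := exists_eq_some_of_le hP (Nat.le_add_right i τ)
          (hsome (i + τ) (by omega))
        rwa [hp, Option.getD_some]
      · rw [hsome i (by omega), hsome (i + τ) (by omega)]
        exact congrArg some he
    have hs : ∀ i < n, M.PairStep ((P i).getD t, (P (i + τ)).getD t)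
        ((P (i + 1)).getD t, (P (i + 1 + τ)).getD t) := fun i hi =>
      ⟨W i, hstep i (by omega), by
        have := hstep (i + τ) (by omega)
        rwa [hW, add_right_comm] at this⟩
    obtain ⟨i₁, i₂, hi, hi₂, h1, h2⟩ := h.exists_repeat (A := fun i => (P i).getD t)
      (B := fun i => (P (i + τ)).getD t) hs hr
    have hall : ∀ l, ∃ x, P l = some x := by
      intro l
      obtain ⟨x, hx, -⟩ := hM.reaches_of_repeat hτ hW hP hi (hsome i₁ (by omega))
        (by rw [hsome i₂ (by omega)]; exact congrArg some h1.symm) (hsome (i₁ + τ) (by omega))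
        (by rw [hsome (i₂ + τ) (by omega)]; exact congrArg some h2.symm) (Nat.le_add_left i₂ l)
      obtain ⟨p, hp, -⟩ := exists_eq_some_of_le hP (Nat.le_add_right l i₂) hx
      exact ⟨p, hp⟩
    choose A hA using hall
    rw [← ht, hA, hA]
    refine congrArg some (h.eq_add_period_of_run hM hτ hW fun i => ?_)
    have := hP i
    rw [hA, hA, Option.bind_some] at this
    exact this.symm

/-- From `X g = d X` it follows that `X g g = d d X`: both words are prefixes, of lengths `n + τ`
and `n + 2τ`, of the periodic word `d d d …` with `τ` the length of `d`. -/
theorem SimplePathsShorter.run_loop_idem {m n : ℕ} (hM : M.RunTestable m)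
    (h : M.SimplePathsShorter n) {X g : List α} (hX : X.length = n) (hg : X <:+ X ++ g) (p : σ) :
    M.run p (X ++ g) = M.run p (X ++ g ++ g) := by
  by_cases hg0 : g = []
  · simp [hg0]
  obtain ⟨d, hd⟩ := hg
  have hτ : 0 < d.length := by
    have := congrArg length hd
    have := length_pos_of_ne_nil hg0
    simp only [length_append] at *
    omega
  have hlen : g.length = d.length := by
    have := congrArg length hd
    simp only [length_append] at this
    omega
  set W : ℕ → α := fun i => d[i % d.length]'(Nat.mod_lt _ hτ) with hWdef
  have hW : ∀ i, W (i + d.length) = W i := fun i => by simp [hWdef]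
  have hd2 : X ++ g ++ g = d ++ (X ++ g) := by rw [← append_assoc, hd]
  have hget : ∀ i (hi : i < (X ++ g ++ g).length), (X ++ g ++ g)[i] = W i := by
    intro i
    induction i using Nat.strong_induction_on with
    | _ i ih =>
      intro hi
      by_cases hid : i < d.length
      · rw [getElem_of_eq hd2, getElem_append_left hid]
        simp [hWdef, Nat.mod_eq_of_lt hid]
      · obtain ⟨i', rfl⟩ : ∃ i', i = i' + d.length := ⟨i - d.length, by omega⟩
        simp only [length_append] at hi
        have hi' : i' < (X ++ g).length := by rw [length_append]; omega
        rw [hW, ← ih i' (by omega) (by simp only [length_append]; omega), getElem_of_eq hd2,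
          getElem_append_right (by omega), getElem_append_left hi']
        simp
  have e2 : X ++ g ++ g = segment W 0 (n + d.length + d.length) := by
    refine ext_getElem (by simp [segment, hX, hlen, add_assoc]) fun i h1 h2 => ?_
    rw [hget i h1]
    simp [segment]
  have e1 : X ++ g = segment W 0 (n + d.length) := by
    refine ext_getElem (by simp [segment, hX, hlen]) fun i h1 h2 => ?_
    have hi : i < (X ++ g ++ g).length := by rw [length_append]; omega
    rw [← getElem_append_left (bs := g) (h' := hi) h1, hget]
    simp [segment]
  rw [e2, e1]
  refine h.run_periodic hM hτ hW (P := fun i => M.run p (segment W 0 i)) fun i => ?_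
  simp only [segment_succ, run_append, run_singleton, zero_add]

/-! ### Loops at a window commute -/

section Loops

variable {m n : ℕ} (hM : M.RunTestable m) (h : M.SimplePathsShorter n) {X g g' : List α}
  (hX : X.length = n)
include hM h hX

theorem SimplePathsShorter.run_loop_fixed (hg : X <:+ X ++ g) {p s t : σ} (hs : M.run p X = some s)
    (ht : M.run s g = some t) : M.run t g = some t ∧ ∃ b, M.run b X = some t := by
  have h1 : M.run p (X ++ g) = some t := by rw [run_append_of_eq hs, ht]
  constructor
  · have := h.run_loop_idem hM hX hg p
    rw [run_append_of_eq h1, h1] at this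
    exact this.symm
  · obtain ⟨d, hd⟩ := hg
    rw [← hd] at h1
    obtain ⟨b, -, hb⟩ := run_append_eq_some.1 h1
    exact ⟨b, hb⟩

/-- Since `t` can read `g` and go on to `r`, the recurrent state `r` can read `g` and come back. The
state `r g` is recurrent too, in the component of `r`, hence equal to `r`. -/
theorem SimplePathsShorter.run_loop_absorb (hg : X <:+ X ++ g) (hg0 : g ≠ [])
    (hg' : X <:+ X ++ g') (hg0' : g' ≠ []) {p t r : σ} (hp : M.run p X = some t)
    (ht : M.run t g = some t) (hr : M.run t g' = some r) : M.run r g = some r := by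
  obtain ⟨hrr, b, hb⟩ := h.run_loop_fixed hM hX hg' hp hr
  have hrec : M.Recurrent X r := recurrent_of_loop hg' hg0' hrr
  obtain ⟨z, hz⟩ := (hrec.reaches_iff hM h hX hp ⟨_, hr⟩ g).1
    ⟨g', by rw [run_append_of_eq ht, hr]⟩
  obtain ⟨r₁, hr₁, hz⟩ := run_append_eq_some.1 hz
  obtain ⟨hrr₁, -⟩ := h.run_loop_fixed hM hX hg hb hr₁
  have := hrec.eq_of_sameSCC hM h hX (recurrent_of_loop hg hg0 hrr₁) ⟨⟨_, hr₁⟩, _, hz⟩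
  rw [hr₁, ← this]

theorem SimplePathsShorter.run_loop_swap_reaches (hg : X <:+ X ++ g) (hg0 : g ≠ [])
    (hg' : X <:+ X ++ g') (hg0' : g' ≠ []) {p s t r : σ} (hs : M.run p X = some s)
    (ht : M.run s g = some t) (hr : M.run t g' = some r) :
    M.Recurrent X r ∧ ∃ s' s'', M.run s g' = some s' ∧ M.run s' g = some s'' ∧ M.Reaches s'' r := by
  obtain ⟨htt, b, hb⟩ := h.run_loop_fixed hM hX hg hs ht
  obtain ⟨hrr, -⟩ := h.run_loop_fixed hM hX hg' hb hr
  have hrg := h.run_loop_absorb hM hX hg hg0 hg' hg0' hb htt hr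
  have hrec : M.Recurrent X r := recurrent_of_loop hg' hg0' hrr
  obtain ⟨z, hz⟩ := (hrec.reaches_iff hM h hX hs (Reaches.trans ⟨_, ht⟩ ⟨_, hr⟩) g').2
    ⟨[], by rw [append_nil, hrr]⟩
  obtain ⟨s', hs', hz⟩ := run_append_eq_some.1 hz
  obtain ⟨-, b', hb'⟩ := h.run_loop_fixed hM hX hg' hs hs'
  obtain ⟨z', hz'⟩ := (hrec.reaches_iff hM h hX hb' ⟨_, hz⟩ g).2 ⟨[], by rw [append_nil, hrg]⟩
  obtain ⟨s'', hs'', hz'⟩ := run_append_eq_some.1 hz'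
  exact ⟨hrec, s', s'', hs', hs'', _, hz'⟩

/-- By `SimplePathsShorter.run_loop_swap_reaches`, used in both orders, the two end states reach
each other. Both are recurrent for `X`, so they coincide. -/
theorem SimplePathsShorter.run_loop_comm (hg : X <:+ X ++ g) (hg' : X <:+ X ++ g') (p : σ) :
    M.run p (X ++ g ++ g') = M.run p (X ++ g' ++ g) := by
  by_cases hg0 : g = []
  · simp [hg0]
  by_cases hg0' : g' = []
  · simp [hg0']
  have key : ∀ {g g' : List α}, X <:+ X ++ g → g ≠ [] → X <:+ X ++ g' → g' ≠ [] → ∀ {r},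
      M.run p (X ++ g ++ g') = some r → M.run p (X ++ g' ++ g) = some r := by
    intro g g' hg hg0 hg' hg0' r hr
    obtain ⟨t, ht, hr⟩ := run_append_eq_some.1 hr
    obtain ⟨s, hs, ht⟩ := run_append_eq_some.1 ht
    obtain ⟨hrec, s', s'', hs', hs'', hreach⟩ :=
      h.run_loop_swap_reaches hM hX hg hg0 hg' hg0' hs ht hr
    obtain ⟨hrec', t₁, r₁, ht₁, hr₁, hreach'⟩ :=
      h.run_loop_swap_reaches hM hX hg' hg0' hg hg0 hs hs' hs''
    obtain rfl : t = t₁ := by rw [ht] at ht₁; exact Option.some.inj ht₁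
    obtain rfl : r = r₁ := by rw [hr] at hr₁; exact Option.some.inj hr₁
    rw [append_assoc, run_append_of_eq hs, run_append_of_eq hs', hs'',
      hrec.eq_of_sameSCC hM h hX hrec' ⟨hreach', hreach⟩]
  cases h1 : M.run p (X ++ g ++ g') with
  | some r => exact (key hg hg0 hg' hg0' h1).symm
  | none =>
    cases h2 : M.run p (X ++ g' ++ g) with
    | none => rfl
    | some r => rw [key hg' hg0' hg hg0 h2] at h1; simp at h1

end Loops

theorem SimplePathsShorter.isLocalSemilatticeCongruence {m n : ℕ} (hM : M.RunTestable m)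
    (h : M.SimplePathsShorter n) :
    IsLocalSemilatticeCongruence n fun u v : List α =>
      SameTestData (n + 1) u v ∧ ∀ p, M.run p u = M.run p v where
  equiv :=
    ⟨fun _ => ⟨⟨rfl, rfl, rfl⟩, fun _ => rfl⟩,
      fun ⟨⟨a, b, c⟩, d⟩ => ⟨⟨a.symm, b.symm, c.symm⟩, fun p => (d p).symm⟩,
      fun ⟨⟨a, b, c⟩, d⟩ ⟨⟨a', b', c'⟩, d'⟩ =>
        ⟨⟨a.trans a', b.trans b', c.trans c'⟩, fun p => (d p).trans (d' p)⟩⟩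
  append a b h := ⟨h.1.append (Nat.succ_pos n) a b, fun p => by simp only [run_append, h.2]⟩
  factors h := h.1.2.2
  idem := by
    intro X g hX hg
    have hg2 : X <:+ X ++ g ++ g := by rwa [suffix_append_iff_of_suffix hg le_rfl]
    refine ⟨SameTestData.of_factors (Nat.succ_pos n) (by omega) (prefix_append X g)
      ((prefix_append X g).trans (prefix_append _ g)) hg hg2 ?_, h.run_loop_idem hM hX hg⟩
    rw [factorsOfLength_append hg (by omega), Set.union_self]
  comm := by
    intro X g g' hX hg hg'
    have h1 : X <:+ X ++ g ++ g' := by rwa [suffix_append_iff_of_suffix hg le_rfl]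
    have h2 : X <:+ X ++ g' ++ g := by rwa [suffix_append_iff_of_suffix hg' le_rfl]
    refine ⟨SameTestData.of_factors (Nat.succ_pos n) (by omega)
      ((prefix_append X g).trans (prefix_append _ g'))
      ((prefix_append X g').trans (prefix_append _ g)) h1 h2 ?_, h.run_loop_comm hM hX hg hg'⟩
    rw [factorsOfLength_append hg (by omega), factorsOfLength_append hg' (by omega), Set.union_comm]

/-- If all simple paths of the 2-tuple graph have fewer than `n` edges, then words with the same
data of `(n + 1)`-testability act in the same way on the states. -/
theorem SimplePathsShorter.runTestable {m n : ℕ} (hM : M.RunTestable m)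
    (h : M.SimplePathsShorter n) : M.RunTestable (n + 1) := by
  refine ⟨Nat.succ_pos n, fun u v _ _ huv => ?_⟩
  rw [sameTestData_succ_iff] at huv
  rcases huv with rfl | ⟨X, Y, hX, hY, ⟨x, rfl⟩, ⟨y, rfl⟩, h3, h4, h5⟩
  · exact fun _ => rfl
  · exact ((h.isLocalSemilatticeCongruence hM).of_same_factors hY (x.length + 1) X x y
      (Nat.lt_succ_self _) hX h3 h4 h5).2

end PartialDFA

/-! ### The theorem -/

theorem theorem3p10 {α : Type u} {σ : Type v} [Finite σ] (M : PartialDFA α σ)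
    (hred : M.IsReduced) (hlt : M.IsLocallyTestable) (k : ℕ) (hk : 2 ≤ k)
    (hmax : IsGreatest
      {n : ℕ | ∃ P : M.TuplePath n, P.IsSCCRestricted ∨ P.IsSCCSemirestricted} (k - 2)) :
    (¬ SatisfiesBeta (k - 1) M.transitionSemigroup ∧
      ¬ IsTestableSemigroup (k - 1) M.transitionSemigroup ∧
      ¬ M.IsTestable (k - 1) ∧
      k ∈ lowerBounds {j : ℕ | M.IsTestable j}) ∧
    ((∀ (n : ℕ) (P : M.TuplePath n), P.IsSimple → n ≤ k - 2) →
      M.IsPreciselyTestable k) := by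
  obtain ⟨m, hm⟩ := hlt
  have hM := hm.runTestable hred
  have hβ : ¬ SatisfiesBeta (k - 1) M.transitionSemigroup := by
    rw [show k - 1 = k - 2 + 1 by omega]
    obtain ⟨P, hP | hP⟩ := hmax.1
    exacts [hP.not_satisfiesBeta hM, hP.not_satisfiesBeta]
  have hnot : ¬ M.IsTestable (k - 1) := fun h => hβ (h.runTestable hred).satisfiesBeta
  have hlb : k ∈ lowerBounds {j : ℕ | M.IsTestable j} := by
    intro j hj
    by_contra hlt
    exact hnot (IsTestableLanguage.mono (by omega) hj)
  refine ⟨⟨hβ, fun h => hβ h.satisfiesBeta, hnot, hlb⟩, fun hs => ⟨?_, hlb⟩⟩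
  -- Windows have length `k - 1`, one more than the longest simple path has edges, and factors have
  -- length `k`.
  have h : M.SimplePathsShorter (k - 1) := fun n P hP => by
    have := hs n P hP
    omega
  have := (h.runTestable hM).isTestable
  rwa [show k - 1 + 1 = k by omega] at this
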